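/- Let $(\Omega,\mathcal A,P)$ be a probability space. Let $f=\{f(x):x\in\mathbb R\}$ be a real zero-mean Gaussian process on it with almost surely continuous sample paths, whose covariance function $c_f(x_1,x_2)$, $x_1,x_2\in\mathbb R$, is four times continuously differentiable, and suppose that $f$ and its mean square derivatives $f'$, $f''$ have bounded variances, that is, $\sup_{x\in\mathbb R}\frac{\partial^{2k}c_f}{\partial x_1^k\partial x_2^k}(x,x)<\infty$ for $k=0,1,2$ (for instance, $c_f(x_1,x_2)$ depends only on $x_1-x_2$). Let $S\subset\mathbb R^2$ be compact and such that at each of its points the tangent directions of $S$ span $\mathbb R^2$ (so that derivatives on $S$ are unique; for example a rectangle of positive area). Let $\{Z(s):s\in S\}$ be a square integrable random field on the same probability space, not necessarily Gaussian and not necessarily independent of $f$, such that 1. $E(Z(s))=0$ for all $s\in S$; 2. its covariance function $c_Z(s_1,s_2)$, $s_1,s_2\in S$, is four times continuously differentiable, i.e. the restriction to $S\times S$ of a four times continuously differentiable function on $\mathbb R^2\times\mathbb R^2$; 3. the mean square partial derivatives $\frac{\partial Z(s)}{\partial s_i}$, $i=1,2$, i.e. the components of the mean square gradient of $Z$ at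 $s$, have finite fourth moments for every $s\in S$. Then the process $g(s)=f(Z(s))$, $s\in S$, is mean square differentiable: $E\,g(s)^2<\infty$ for every $s\in S$, and for every $s\in S$ there are square integrable random variables $D_1,D_2$ such that $$\frac{g(t)-g(s)-\sum_{i=1}^2 (t_i-s_i)D_i}{\|t-s\|}\longrightarrow 0\quad\text{in }L^2(P)\text{ as }t\to s,\ t\in S\setminus\{s\}.$$ -/

import Mathlib

open MeasureTheory ProbabilityTheory Filter Topology

/-- The plane `ℝ²` with its Euclidean norm. -/
abbrev Plane : Type := EuclideanSpace ℝ (Fin 2)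

/-- `D = (D 0, D 1)` is a mean square gradient at `s` of the random field `Z` on `S`:
`Z t = Z s + ∑ i, (t i - s i) * D i + R` with `D i` square integrable and `R / ‖t - s‖ → 0` in `L²`
as `t → s` in `S`. Its components are the mean square partial derivatives of `Z` at `s`. -/
def IsMeanSquareGradient {Ω : Type*} [MeasurableSpace Ω] (P : Measure Ω) (S : Set Plane)
    (Z : Plane → Ω → ℝ) (s : Plane) (D : Fin 2 → Ω → ℝ) : Prop :=
  (∀ i, MemLp (D i) 2 P) ∧
    Tendsto
      (fun t : Plane =>
        eLpNorm (fun ω => (Z t ω - Z s ω - ∑ i, (t i - s i) * D i ω) / ‖t - s‖) 2 P)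
      (𝓝[S \ {s}] s) (𝓝 0)

/-- The random field `Z` is square integrable and mean square differentiable on `S`. -/
def MeanSquareDifferentiableOn {Ω : Type*} [MeasurableSpace Ω] (P : Measure Ω) (S : Set Plane)
    (Z : Plane → Ω → ℝ) : Prop :=
  ∀ s ∈ S, MemLp (Z s) 2 P ∧ ∃ D : Fin 2 → Ω → ℝ, IsMeanSquareGradient P S Z s D

/-- The covariance function of a process with index set `T`. -/
noncomputable def covFun {Ω T : Type*} [MeasurableSpace Ω] (P : Measure Ω) (X : T → Ω → ℝ) :
    T × T → ℝ :=
  fun p => cov[X p.1, X p.2; P]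

/-- A function on a closed set `A` of a normed space is `n` times continuously differentiable on
`A` (up to the boundary) if it is the restriction of an `n` times continuously differentiable
function on the whole space. -/
def IsContDiffUpTo {E : Type*} [NormedAddCommGroup E] [NormedSpace ℝ E] (n : ℕ) (A : Set E)
    (c : E → ℝ) : Prop :=
  ∃ K : E → ℝ, ContDiff ℝ n K ∧ Set.EqOn c K A

/-- `∂^{2k} c / ∂x₁^k ∂x₂^k` at `(x, x)`. For a sufficiently smooth covariance function `c` this is
the variance at `x` of the `k`-th mean square derivative of the process. -/
noncomputable def diagMixedDeriv (c : ℝ × ℝ → ℝ) (k : ℕ) (x : ℝ) : ℝ :=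
  iteratedDeriv k (fun x₁ => iteratedDeriv k (fun x₂ => c (x₁, x₂)) x) x

/-! `Z` may depend on `f` in any way, so `f (Z s)` is treated path by path, with a random Taylor
constant that is valid at all pairs of points at once and has enough moments. Almost every path `F`
is shown to satisfy `(F y - F x - F' x * (y - x)) ^ 2 ≤ 128 * K ^ 2 * |y - x| ^ 3` with `K ^ 8 = W +
(3 + |x| + |y|) ^ 2`, where `W` is a single integrable random variable (`taylor_of_dyadic_bound`).
At `x = Z s`, `y = Z t` the variable `K ^ 8` stays integrable, uniformly in `t`, because the second
moments of `Z` are bounded on the compact set `S`.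

The path estimate is of Kolmogorov type. Bounded variance of `f''` makes the variance of a second
difference with step `h` at most `B * h ^ 4`; by Gaussianity its sixteenth moment is `O(h ^ 32)`.
This leaves room to sum over all dyadic scales and, with summable weights, over all positions on the
line (`exists_dyadic_bound_of_isGaussianProcess`). The result is second differences of size `3 ^
(-k)` at scale `2 ^ (-k)`; then slopes of dyadic chords converge, and since `9 > 8` the Taylor
remainder is of order at most `3 / 2` (`DyadicSmooth.taylor`).

The field `Z` is viewed as an `L²` valued map with a smooth Gram kernel. Combinations of its
increments are controlled by the kernel, which yields a gradient on `S` whose remainder `r`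
satisfies `E r² ≤ A² ‖t - s‖⁴` (`exists_gradient_of_contDiff_covFun`).

Finally `Z t - Z s = v + r` with `v` linear in `t - s`. Only second moments of `r` are known, so the
Taylor bound is used where `|r|` is small and the crude bound `|f| ≤ 4 * K` where it is large.
Young's inequality separates `K`, the gradient and `r` (`exists_sq_error_le`), and taking
expectations gives the limit. -/

/-! ### Dyadic interpolation and a pathwise Taylor expansion -/

/-- The symmetric second difference of `F` with step `h`. -/
def secondDiff (F : ℝ → ℝ) (h x : ℝ) : ℝ := F (x + h) - 2 * F x + F (x - h)

/-- The slope of the chord of `F` over the `j`-th dyadic interval of level `k`. -/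
noncomputable def dyadicSlope (F : ℝ → ℝ) (k : ℕ) (j : ℤ) : ℝ :=
  2 ^ k * (F ((j + 1 : ℝ) / 2 ^ k) - F (j / 2 ^ k))

/-- The index of the dyadic interval of level `k` containing `z`. -/
noncomputable def dyadicIndex (k : ℕ) (z : ℝ) : ℤ := ⌊z * 2 ^ k⌋

/-- The dyadic piecewise linear interpolation of `F` of level `k`. -/
noncomputable def dyadicChord (F : ℝ → ℝ) (k : ℕ) (z : ℝ) : ℝ :=
  F (dyadicIndex k z / 2 ^ k) + dyadicSlope F k (dyadicIndex k z) * (z - dyadicIndex k z / 2 ^ k)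

lemma dyadicIndex_le (k : ℕ) (z : ℝ) : (dyadicIndex k z : ℝ) / 2 ^ k ≤ z := by
  rw [div_le_iff₀ (by positivity)]
  exact Int.floor_le _

lemma lt_dyadicIndex_add_one (k : ℕ) (z : ℝ) : z < ((dyadicIndex k z : ℝ) + 1) / 2 ^ k := by
  rw [lt_div_iff₀ (by positivity)]
  exact Int.lt_floor_add_one _

lemma dyadicIndex_succ (k : ℕ) (z : ℝ) :
    dyadicIndex (k + 1) z = 2 * dyadicIndex k z ∨
      dyadicIndex (k + 1) z = 2 * dyadicIndex k z + 1 := by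
  have h1 := Int.floor_le (z * 2 ^ k)
  have h2 := Int.lt_floor_add_one (z * 2 ^ k)
  have h3 := Int.floor_le (z * 2 ^ (k + 1))
  have h4 := Int.lt_floor_add_one (z * 2 ^ (k + 1))
  have h5 : z * 2 ^ (k + 1) = 2 * (z * 2 ^ k) := by ring
  unfold dyadicIndex
  rw [h5] at h3 h4 ⊢
  have a1 : (⌊2 * (z * 2 ^ k)⌋ : ℝ) < 2 * ⌊z * 2 ^ k⌋ + 2 := by linarith
  have a2 : (2 * ⌊z * 2 ^ k⌋ : ℝ) < ⌊2 * (z * 2 ^ k)⌋ + 1 := by linarith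
  have b1 : (⌊2 * (z * 2 ^ k)⌋ : ℤ) < 2 * ⌊z * 2 ^ k⌋ + 2 := by exact_mod_cast a1
  have b2 : (2 * ⌊z * 2 ^ k⌋ : ℤ) < ⌊2 * (z * 2 ^ k)⌋ + 1 := by exact_mod_cast a2
  omega

/-- Smallness of the dyadic second differences of `F` centred in `[-r, r]`. -/
def DyadicSmooth (F : ℝ → ℝ) (K r : ℝ) : Prop :=
  ∀ (k : ℕ) (j : ℤ), |(j : ℝ) / 2 ^ k| ≤ r → |secondDiff F (1 / 2 ^ k) (j / 2 ^ k)| ≤ K / 3 ^ k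

lemma DyadicSmooth.nonneg {F : ℝ → ℝ} {K r : ℝ} (h : DyadicSmooth F K r) (hr : 0 ≤ r) : 0 ≤ K := by
  have := (abs_nonneg _).trans (h 0 0 (by simpa using hr))
  simpa using this

lemma abs_dyadic_le {k : ℕ} {z : ℝ} {t : ℝ} (h0 : (dyadicIndex k z : ℝ) / 2 ^ k ≤ t)
    (h1 : t ≤ ((dyadicIndex k z : ℝ) + 1) / 2 ^ k) : |t| ≤ |z| + 1 := by
  have h2 := dyadicIndex_le k z
  have h3 := lt_dyadicIndex_add_one k z
  have h4 : (1 : ℝ) / 2 ^ k ≤ 1 := by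
    rw [div_le_one (by positivity)]; exact one_le_pow₀ (by norm_num)
  rw [add_div] at h1 h3
  have h5 := neg_abs_le z
  have h6 := le_abs_self z
  rw [abs_le]
  constructor <;> linarith

/-- Halving an interval changes the slope on either half by the same amount up to sign, and that
amount is the second difference at the midpoint. -/
lemma dyadicSlope_succ_sub {F : ℝ → ℝ} (k : ℕ) (z : ℝ) :
    |dyadicSlope F (k + 1) (dyadicIndex (k + 1) z) - dyadicSlope F k (dyadicIndex k z)| =
      2 ^ k * |secondDiff F (1 / 2 ^ (k + 1)) ((2 * dyadicIndex k z + 1 : ℤ) / 2 ^ (k + 1))| := by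
  set j := dyadicIndex k z
  have e1 : ((2 * j + 1 : ℤ) : ℝ) / 2 ^ (k + 1) + 1 / 2 ^ (k + 1) = ((j : ℝ) + 1) / 2 ^ k := by
    push_cast; field_simp; ring
  have e2 : ((2 * j + 1 : ℤ) : ℝ) / 2 ^ (k + 1) - 1 / 2 ^ (k + 1) = (j : ℝ) / 2 ^ k := by
    push_cast; field_simp; ring
  have e3 : ((2 * j + 1 : ℤ) : ℝ) / 2 ^ (k + 1) = (2 * (j : ℝ) + 1) / 2 ^ (k + 1) := by
    push_cast; ring
  have e4 : (2 * (j : ℝ)) / 2 ^ (k + 1) = j / 2 ^ k := by field_simp; ring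
  have e5 : (2 * (j : ℝ) + 1 + 1) / 2 ^ (k + 1) = (j + 1) / 2 ^ k := by field_simp; ring
  unfold secondDiff
  rw [e1, e2, e3]
  have hp : ∀ a : ℝ, (2 : ℝ) ^ k * |a| = |2 ^ k * a| := fun a => by
    rw [abs_mul, abs_of_pos (show (0 : ℝ) < 2 ^ k by positivity)]
  rcases dyadicIndex_succ k z with h | h
  · rw [h]
    unfold dyadicSlope
    push_cast
    rw [e4]
    rw [hp, ← abs_neg]
    congr 1; ring
  · rw [h]
    unfold dyadicSlope
    push_cast
    rw [e5]
    rw [hp]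
    congr 1; ring

/-- The finer interpolation agrees with the coarser one at both ends of the coarse interval. On each
half the difference is therefore the slope change times the distance to the coarse endpoint of that
half. -/
lemma dyadicChord_succ_sub {F : ℝ → ℝ} (k : ℕ) (z : ℝ) :
    |dyadicChord F (k + 1) z - dyadicChord F k z| ≤
      |dyadicSlope F (k + 1) (dyadicIndex (k + 1) z) - dyadicSlope F k (dyadicIndex k z)| *
        (1 / 2 ^ (k + 1)) := by
  set j := dyadicIndex k z with hj
  have h1 := dyadicIndex_le (k + 1) z
  have h2 := lt_dyadicIndex_add_one (k + 1) z
  have e4 : (2 * (j : ℝ)) / 2 ^ (k + 1) = j / 2 ^ k := by field_simp; ring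
  have e5 : (2 * (j : ℝ) + 1 + 1) / 2 ^ (k + 1) = (j + 1) / 2 ^ k := by field_simp; ring
  rcases dyadicIndex_succ k z with h | h
  · have : dyadicChord F (k + 1) z - dyadicChord F k z =
        (dyadicSlope F (k + 1) (dyadicIndex (k + 1) z) - dyadicSlope F k (dyadicIndex k z)) *
          (z - (dyadicIndex (k + 1) z : ℝ) / 2 ^ (k + 1)) := by
      unfold dyadicChord
      rw [h]; push_cast; rw [← hj, e4]; ring
    rw [this, abs_mul]
    gcongr
    rw [add_div] at h2
    rw [abs_of_nonneg (by linarith)]; linarith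
  · have : dyadicChord F (k + 1) z - dyadicChord F k z =
        (dyadicSlope F (k + 1) (dyadicIndex (k + 1) z) - dyadicSlope F k (dyadicIndex k z)) *
          (z - ((dyadicIndex (k + 1) z : ℝ) + 1) / 2 ^ (k + 1)) := by
      unfold dyadicChord
      rw [h]; push_cast; rw [← hj, e5]
      unfold dyadicSlope
      push_cast; rw [e5]; field_simp; ring
    rw [this, abs_mul]
    gcongr
    rw [add_div] at h2 ⊢
    rw [abs_le]; constructor <;> linarith [show (0 : ℝ) ≤ 1 / 2 ^ (k + 1) by positivity]

lemma tendsto_dyadicIndex_div (z : ℝ) :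
    Tendsto (fun k => (dyadicIndex k z : ℝ) / 2 ^ k) atTop (𝓝 z) := by
  have hp : Tendsto (fun k : ℕ => (1 : ℝ) / 2 ^ k) atTop (𝓝 0) := by
    simpa using tendsto_pow_atTop_nhds_zero_of_lt_one (r := (1 / 2 : ℝ)) (by norm_num) (by norm_num)
  refine tendsto_of_tendsto_of_tendsto_of_le_of_le (g := fun k : ℕ => z - 1 / 2 ^ k)
    (by simpa using (tendsto_const_nhds (x := z)).sub hp) tendsto_const_nhds (fun k => ?_)
    (fun k => dyadicIndex_le k z)
  have := lt_dyadicIndex_add_one k z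
  rw [add_div] at this
  simp only; linarith

lemma tendsto_dyadicChord {F : ℝ → ℝ} (hF : Continuous F) (z : ℝ) :
    Tendsto (fun k => dyadicChord F k z) atTop (𝓝 (F z)) := by
  have hp : Tendsto (fun k : ℕ => (1 : ℝ) / 2 ^ k) atTop (𝓝 0) := by
    simpa using tendsto_pow_atTop_nhds_zero_of_lt_one (r := (1 / 2 : ℝ)) (by norm_num) (by norm_num)
  have ha := tendsto_dyadicIndex_div z
  have hb : Tendsto (fun k => ((dyadicIndex k z : ℝ) + 1) / 2 ^ k) atTop (𝓝 z) := by
    simpa [add_div] using ha.add hp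
  have hFa := (hF.tendsto z).comp ha
  have hFb := (hF.tendsto z).comp hb
  have h1 := hFb.sub hFa
  rw [sub_self] at h1
  have h2 : Tendsto (fun k => dyadicSlope F k (dyadicIndex k z) * (z - dyadicIndex k z / 2 ^ k))
      atTop (𝓝 0) := by
    refine squeeze_zero_norm (fun k => ?_) (by simpa using h1.abs)
    have h3 := lt_dyadicIndex_add_one k z
    have h4 := dyadicIndex_le k z
    rw [add_div] at h3
    unfold dyadicSlope
    have h5 : |z - dyadicIndex k z / 2 ^ k| ≤ 1 / 2 ^ k := by
      rw [abs_of_nonneg (by linarith)]; linarith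
    rw [Real.norm_eq_abs, abs_mul, abs_mul, abs_of_pos (show (0 : ℝ) < 2 ^ k by positivity)]
    calc _ ≤ _ * (1 / 2 ^ k) := mul_le_mul_of_nonneg_left h5 (by positivity)
      _ = _ := by field_simp
  simpa [dyadicChord] using hFa.add h2

lemma DyadicSmooth.slope_succ {F : ℝ → ℝ} {K r z : ℝ} (h : DyadicSmooth F K r) (hz : |z| + 1 ≤ r)
    (k : ℕ) :
    |dyadicSlope F (k + 1) (dyadicIndex (k + 1) z) - dyadicSlope F k (dyadicIndex k z)| ≤
      K / 3 * (2 / 3) ^ k := by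
  rw [dyadicSlope_succ_sub]
  have e : (dyadicIndex k z : ℝ) / 2 ^ k ≤ ((2 * dyadicIndex k z + 1 : ℤ) : ℝ) / 2 ^ (k + 1) := by
    push_cast; rw [div_le_div_iff₀ (by positivity) (by positivity), pow_succ]
    nlinarith [show (0 : ℝ) < 2 ^ k by positivity]
  have e' : ((2 * dyadicIndex k z + 1 : ℤ) : ℝ) / 2 ^ (k + 1) ≤
      ((dyadicIndex k z : ℝ) + 1) / 2 ^ k := by
    push_cast; rw [div_le_div_iff₀ (by positivity) (by positivity), pow_succ]
    nlinarith [show (0 : ℝ) < 2 ^ k by positivity]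
  have := h (k + 1) (2 * dyadicIndex k z + 1) ((abs_dyadic_le e e').trans hz)
  calc _ ≤ 2 ^ k * (K / 3 ^ (k + 1)) := by gcongr
    _ = _ := by rw [div_pow]; field_simp; ring

/-- One refinement changes the slope by at most `2 ^ k * (K / 3 ^ (k + 1))`, a geometric sequence of
ratio `2 / 3 < 1`. The limit `φ` is the future derivative at `z`. -/
lemma DyadicSmooth.exists_slope {F : ℝ → ℝ} {K r z : ℝ} (h : DyadicSmooth F K r)
    (hz : |z| + 1 ≤ r) :
    ∃ φ : ℝ, ∀ k, |dyadicSlope F k (dyadicIndex k z) - φ| ≤ K * (2 / 3) ^ k := by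
  have hd : ∀ k, dist (dyadicSlope F k (dyadicIndex k z))
      (dyadicSlope F (k + 1) (dyadicIndex (k + 1) z)) ≤ K / 3 * (2 / 3) ^ k := fun k => by
    rw [dist_comm]; exact h.slope_succ hz k
  obtain ⟨φ, hφ⟩ := cauchySeq_tendsto_of_complete
    (cauchySeq_of_le_geometric (2 / 3) (K / 3) (by norm_num) hd)
  refine ⟨φ, fun k => ?_⟩
  have := dist_le_of_le_geometric_of_tendsto (2 / 3) (K / 3) (by norm_num) hd hφ k
  rw [Real.dist_eq] at this
  refine this.trans (le_of_eq ?_)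
  ring

/-- The chords telescope to `F` with increments of ratio `1 / 3`: the slope changes of ratio `2 / 3`
act over half intervals. -/
lemma DyadicSmooth.chord_sub {F : ℝ → ℝ} {K r z : ℝ} (h : DyadicSmooth F K r) (hF : Continuous F)
    (hz : |z| + 1 ≤ r) (k : ℕ) : |dyadicChord F k z - F z| ≤ K / 3 ^ k := by
  have hK : 0 ≤ K := h.nonneg (by linarith [abs_nonneg z])
  have hd : ∀ k, dist (dyadicChord F k z) (dyadicChord F (k + 1) z) ≤ K / 6 * (1 / 3) ^ k :=
    fun k => by
    rw [dist_comm]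
    refine (dyadicChord_succ_sub k z).trans ?_
    calc _ ≤ (K / 3 * (2 / 3) ^ k) * (1 / 2 ^ (k + 1)) := by gcongr; exact h.slope_succ hz k
      _ = _ := by rw [div_pow, div_pow]; field_simp; ring
  have := dist_le_of_le_geometric_of_tendsto (1 / 3) (K / 6) (by norm_num) hd
    (tendsto_dyadicChord hF z) k
  rw [Real.dist_eq] at this
  refine this.trans ?_
  rw [div_pow, one_pow]
  have : 0 ≤ K / 3 ^ k := by positivity
  calc _ = (K / 3 ^ k) / 4 := by field_simp; ring
    _ ≤ _ := by linarith

lemma DyadicSmooth.slope_adjacent {F : ℝ → ℝ} {K r : ℝ} (h : DyadicSmooth F K r) (k : ℕ) (j : ℤ)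
    (hj : |((j : ℝ) + 1) / 2 ^ k| ≤ r) :
    |dyadicSlope F k (j + 1) - dyadicSlope F k j| ≤ 2 ^ k * (K / 3 ^ k) := by
  have := h k (j + 1) (by push_cast; exact hj)
  unfold secondDiff at this
  have e1 : ((j + 1 : ℤ) : ℝ) / 2 ^ k + 1 / 2 ^ k = (j + 1 + 1) / 2 ^ k := by push_cast; ring
  have e2 : ((j + 1 : ℤ) : ℝ) / 2 ^ k - 1 / 2 ^ k = j / 2 ^ k := by push_cast; ring
  rw [e1, e2] at this
  push_cast at this
  have e3 : dyadicSlope F k (j + 1) - dyadicSlope F k j = 2 ^ k * (F ((j + 1 + 1) / 2 ^ k) -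
      2 * F ((j + 1) / 2 ^ k) + F (j / 2 ^ k)) := by
    unfold dyadicSlope; push_cast; ring
  rw [e3, abs_mul, abs_of_pos (show (0 : ℝ) < 2 ^ k by positivity)]
  gcongr

/-- Points at distance at most `1 / 2 ^ k` lie in the same or in adjacent dyadic intervals, so the
polygon bends at most once between them, and the bend is one second difference. -/
lemma DyadicSmooth.chord_sub_chord {F : ℝ → ℝ} {K r x y : ℝ} (h : DyadicSmooth F K r)
    (hx : |x| + 1 ≤ r) {k : ℕ} (hxy : |y - x| ≤ 1 / 2 ^ k) :
    |dyadicChord F k y - dyadicChord F k x - dyadicSlope F k (dyadicIndex k x) * (y - x)| ≤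
      K / 3 ^ k := by
  have hK : 0 ≤ K := h.nonneg (by linarith [abs_nonneg x])
  have hx1 := dyadicIndex_le k x
  have hx2 := lt_dyadicIndex_add_one k x
  have hy1 := dyadicIndex_le k y
  have hy2 := lt_dyadicIndex_add_one k y
  have hp : (0 : ℝ) < 1 / 2 ^ k := by positivity
  have hlow : ((dyadicIndex k x : ℝ) / 2 ^ k) ≤ (dyadicIndex k x + 1) / 2 ^ k := by
    rw [add_div]; linarith
  have ha := (abs_dyadic_le (k := k) (z := x) le_rfl hlow).trans hx
  have hb := (abs_dyadic_le (k := k) (z := x) hlow le_rfl).trans hx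
  rw [abs_le] at hxy
  have c1 : (dyadicIndex k y : ℝ) < dyadicIndex k x + 2 := by
    rw [← div_lt_div_iff_of_pos_right (show (0 : ℝ) < 2 ^ k by positivity)]
    rw [add_div] at *
    have : (2 : ℝ) / 2 ^ k = 1 / 2 ^ k + 1 / 2 ^ k := by ring
    linarith
  have c2 : (dyadicIndex k x : ℝ) < dyadicIndex k y + 2 := by
    rw [← div_lt_div_iff_of_pos_right (show (0 : ℝ) < 2 ^ k by positivity)]
    rw [add_div] at *
    have : (2 : ℝ) / 2 ^ k = 1 / 2 ^ k + 1 / 2 ^ k := by ring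
    linarith
  have d1 : dyadicIndex k y < dyadicIndex k x + 2 := by exact_mod_cast c1
  have d2 : dyadicIndex k x < dyadicIndex k y + 2 := by exact_mod_cast c2
  have hfin : ∀ w : ℝ, |w| ≤ 1 / 2 ^ k → ∀ s : ℝ, |s| ≤ 2 ^ k * (K / 3 ^ k) →
      |s * w| ≤ K / 3 ^ k := fun w hw s hs => by
    rw [abs_mul]
    calc _ ≤ (2 ^ k * (K / 3 ^ k)) * (1 / 2 ^ k) := by gcongr
      _ = _ := by field_simp
  have hcases : dyadicIndex k y = dyadicIndex k x ∨ dyadicIndex k y = dyadicIndex k x + 1 ∨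
      dyadicIndex k x = dyadicIndex k y + 1 := by omega
  rcases hcases with e | e | e
  · have : dyadicChord F k y - dyadicChord F k x -
        dyadicSlope F k (dyadicIndex k x) * (y - x) = 0 := by
      unfold dyadicChord; rw [e]; ring
    rw [this, abs_zero]; positivity
  · have hs := h.slope_adjacent k (dyadicIndex k x) hb
    have : dyadicChord F k y - dyadicChord F k x - dyadicSlope F k (dyadicIndex k x) * (y - x) =
        (dyadicSlope F k (dyadicIndex k x + 1) - dyadicSlope F k (dyadicIndex k x)) *
          (y - (dyadicIndex k x + 1) / 2 ^ k) := by
      unfold dyadicChord; rw [e]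
      have : F ((dyadicIndex k x + 1) / 2 ^ k) = F (dyadicIndex k x / 2 ^ k) +
          dyadicSlope F k (dyadicIndex k x) * (1 / 2 ^ k) := by
        unfold dyadicSlope; field_simp; ring
      push_cast; rw [this]; ring
    rw [this]
    refine hfin _ ?_ _ hs
    rw [e] at hy1; push_cast at hy1
    rw [abs_of_nonneg (by linarith)]; linarith
  · have hs := h.slope_adjacent k (dyadicIndex k y) (by rw [e] at ha; push_cast at ha; exact ha)
    have : dyadicChord F k y - dyadicChord F k x - dyadicSlope F k (dyadicIndex k x) * (y - x) =
        (dyadicSlope F k (dyadicIndex k y + 1) - dyadicSlope F k (dyadicIndex k y)) *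
          ((dyadicIndex k y + 1) / 2 ^ k - y) := by
      unfold dyadicChord; rw [e]
      have : F ((dyadicIndex k y + 1) / 2 ^ k) = F (dyadicIndex k y / 2 ^ k) +
          dyadicSlope F k (dyadicIndex k y) * (1 / 2 ^ k) := by
        unfold dyadicSlope; field_simp; ring
      push_cast; rw [this]; ring
    rw [this]
    refine hfin _ ?_ _ hs
    rw [abs_of_nonneg (by linarith)]
    rw [add_div] at *; linarith

lemma dyadicSlope_zero_le {F : ℝ → ℝ} {K R z : ℝ}
    (h0 : ∀ n : ℤ, |(n : ℝ)| ≤ R → |F n| ≤ K) (hz : |z| + 1 ≤ R) :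
    |dyadicSlope F 0 (dyadicIndex 0 z)| ≤ 2 * K ∧ |dyadicChord F 0 z| ≤ 3 * K := by
  have hz1 := dyadicIndex_le 0 z
  have hz2 := lt_dyadicIndex_add_one 0 z
  have hlow : ((dyadicIndex 0 z : ℝ) / 2 ^ 0) ≤ (dyadicIndex 0 z + 1) / 2 ^ 0 := by simp
  have ha := h0 (dyadicIndex 0 z)
    (by simpa using (abs_dyadic_le (k := 0) (z := z) le_rfl hlow).trans hz)
  have hb := h0 (dyadicIndex 0 z + 1)
    (by simpa using (abs_dyadic_le (k := 0) (z := z) hlow le_rfl).trans hz)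
  push_cast at hb
  have hs : |dyadicSlope F 0 (dyadicIndex 0 z)| ≤ 2 * K := by
    unfold dyadicSlope
    simp only [pow_zero, div_one, one_mul]
    exact (abs_sub _ _).trans (by linarith)
  refine ⟨hs, ?_⟩
  unfold dyadicChord
  refine (abs_add_le _ _).trans ?_
  simp only [pow_zero, div_one] at *
  rw [abs_mul]
  have : |z - dyadicIndex 0 z| ≤ 1 := by rw [abs_of_nonneg (by linarith)]; linarith
  have := mul_le_mul hs this (abs_nonneg _) ((abs_nonneg _).trans hs)
  linarith

/-- A continuous function with small dyadic second differences has a derivative, with a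
quantitative first order Taylor expansion. -/
theorem DyadicSmooth.taylor {F : ℝ → ℝ} {K R : ℝ} (h : DyadicSmooth F K (R + 2))
    (hF : Continuous F) (h0 : ∀ n : ℤ, |(n : ℝ)| ≤ R + 2 → |F n| ≤ K) {x : ℝ} (hx : |x| ≤ R) :
    |F x| ≤ 4 * K ∧ |deriv F x| ≤ 3 * K ∧ HasDerivAt F (deriv F x) x ∧
      ∀ y, |y| ≤ R → (F y - F x - deriv F x * (y - x)) ^ 2 ≤ 128 * K ^ 2 * |y - x| ^ 3 := by
  have hR : 0 ≤ R := (abs_nonneg x).trans hx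
  have hK : 0 ≤ K := h.nonneg (by linarith)
  have hb : ∀ z, |z| ≤ R + 1 → |F z| ≤ 4 * K := fun z hz => by
    have h1 := (dyadicSlope_zero_le h0 (z := z) (by linarith)).2
    have h2 := h.chord_sub hF (z := z) (by linarith) 0
    rw [pow_zero, div_one, abs_le] at h2
    rw [abs_le] at *
    constructor <;> linarith
  obtain ⟨φ, hφ⟩ := h.exists_slope (z := x) (by linarith)
  have hφb : |φ| ≤ 3 * K := by
    have h1 := (dyadicSlope_zero_le h0 (z := x) (by linarith)).1
    have h2 := hφ 0
    rw [pow_zero, mul_one, abs_le] at h2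
    rw [abs_le] at *
    constructor <;> linarith
  -- The range `R + 1` rather than `R` makes the estimate hold in a full neighbourhood of `x`, which
  -- differentiability needs even when `|x| = R`.
  have key : ∀ y, |y| ≤ R + 1 → (F y - F x - φ * (y - x)) ^ 2 ≤ 128 * K ^ 2 * |y - x| ^ 3 := by
    intro y hy
    rcases lt_or_ge 1 |y - x| with h1 | h1
    · have h2 : |F y - F x - φ * (y - x)| ≤ 11 * K * |y - x| := by
        have a1 := hb y hy
        have a2 := hb x (by linarith)
        have a3 : |φ * (y - x)| ≤ 3 * K * |y - x| := by rw [abs_mul]; gcongr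
        have a4 : 8 * K ≤ 8 * K * |y - x| := by nlinarith
        calc _ ≤ |F y - F x| + |φ * (y - x)| := abs_sub _ _
          _ ≤ |F y| + |F x| + |φ * (y - x)| := by gcongr; exact abs_sub _ _
          _ ≤ _ := by linarith
      rw [← sq_abs]
      calc _ ≤ (11 * K * |y - x|) ^ 2 := by gcongr
        _ = 121 * K ^ 2 * (|y - x| ^ 2 * 1) := by ring
        _ ≤ 128 * K ^ 2 * (|y - x| ^ 2 * |y - x|) := by gcongr; norm_num
        _ = _ := by ring
    · rcases eq_or_lt_of_le (abs_nonneg (y - x)) with h2 | h2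
      · have : y - x = 0 := abs_eq_zero.mp h2.symm
        have e : y = x := by linarith
        simp [e]
      -- The level `k` is matched to the distance: `2 ^ (-(k + 1)) < |y - x| ≤ 2 ^ (-k)`. Four
      -- errors of size `K / 3 ^ k` then add up.
      · obtain ⟨k, hk1, hk2⟩ := exists_nat_pow_near_of_lt_one (x := |y - x|) (y := (1 / 2 : ℝ))
          h2 h1 (by norm_num) (by norm_num)
        have hk2' : |y - x| ≤ 1 / 2 ^ k := by simpa [div_pow] using hk2
        have a1 := h.chord_sub hF (z := y) (by linarith) k
        have a2 := h.chord_sub hF (z := x) (by linarith) k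
        have a3 := h.chord_sub_chord (x := x) (y := y) (by linarith) hk2'
        have a4 : |(dyadicSlope F k (dyadicIndex k x) - φ) * (y - x)| ≤ K / 3 ^ k := by
          rw [abs_mul]
          calc _ ≤ (K * (2 / 3) ^ k) * (1 / 2 ^ k) := by gcongr; exact hφ k
            _ = _ := by rw [div_pow]; field_simp
        have a5 : |F y - F x - φ * (y - x)| ≤ 4 * (K / 3 ^ k) := by
          have e : F y - F x - φ * (y - x) = (dyadicChord F k y - dyadicChord F k x -
              dyadicSlope F k (dyadicIndex k x) * (y - x)) - (dyadicChord F k y - F y) +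
              (dyadicChord F k x - F x) + (dyadicSlope F k (dyadicIndex k x) - φ) * (y - x) := by
            ring
          rw [e]
          rw [abs_le] at *
          constructor <;> linarith
        rw [← sq_abs]
        -- This is where the base `3` matters: `3 ^ 2 ≥ 2 ^ 3` turns the error `3 ^ (-k)` into the
        -- power `3 / 2` of the distance.
        have a6 : (1 / 9 : ℝ) ^ k ≤ 8 * |y - x| ^ 3 := by
          calc (1 / 9 : ℝ) ^ k ≤ (1 / 8) ^ k := by gcongr; norm_num
            _ = 8 * ((1 / 2) ^ (k + 1)) ^ 3 := by
              rw [← pow_mul, mul_comm (k + 1), pow_mul, pow_succ]; norm_num; ring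
            _ ≤ _ := by gcongr
        calc _ ≤ (4 * (K / 3 ^ k)) ^ 2 := by gcongr
          _ = 16 * K ^ 2 * (1 / 9) ^ k := by
            rw [mul_pow, div_pow, ← pow_mul, mul_comm k, pow_mul, div_pow]; norm_num; ring
          _ ≤ 16 * K ^ 2 * (8 * |y - x| ^ 3) := by gcongr
          _ = _ := by ring
  have hder : HasDerivAt F φ x := by
    rw [hasDerivAt_iff_isLittleO]
    have hO : (fun y => F y - F x - (y - x) • φ) =O[𝓝 x] (fun y => |y - x| ^ (3 / 2 : ℝ)) := by
      refine Asymptotics.IsBigO.of_bound (Real.sqrt (128 * K ^ 2)) ?_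
      filter_upwards [Metric.ball_mem_nhds x one_pos] with y hy
      rw [Metric.mem_ball, Real.dist_eq] at hy
      have hy' : |y| ≤ R + 1 := by
        have := abs_sub_abs_le_abs_sub y x
        linarith
      have := Real.abs_le_sqrt (key y hy')
      rw [Real.sqrt_mul (by positivity)] at this
      rw [smul_eq_mul, mul_comm (y - x), Real.norm_eq_abs, Real.norm_eq_abs,
        abs_of_nonneg (Real.rpow_nonneg (abs_nonneg (y - x)) _)]
      refine this.trans (le_of_eq ?_)
      congr 1
      rw [Real.sqrt_eq_rpow, ← Real.rpow_natCast, ← Real.rpow_mul (abs_nonneg _)]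
      norm_num
    refine hO.trans_isLittleO ?_
    have : Tendsto (fun y => |y - x| ^ (1 / 2 : ℝ)) (𝓝 x) (𝓝 0) := by
      have hc : Continuous (fun y : ℝ => |y - x| ^ (1 / 2 : ℝ)) :=
        (continuous_abs.comp (continuous_id.sub continuous_const)).rpow_const
          (fun _ => Or.inr (by norm_num))
      simpa using hc.tendsto x
    have h2 := ((Asymptotics.isLittleO_one_iff ℝ).2 this).mul_isBigO
      (Asymptotics.isBigO_refl (fun y => |y - x|) (𝓝 x))
    have h3 : (fun y => |y - x| ^ (3 / 2 : ℝ)) = fun y => |y - x| ^ (1 / 2 : ℝ) * |y - x| := by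
      funext y
      have : (3 / 2 : ℝ) = 1 / 2 + 1 := by norm_num
      rw [this, Real.rpow_add_one' (abs_nonneg _) (by norm_num)]
    rw [h3]
    simpa using h2.abs_right
  rw [hder.deriv]
  exact ⟨hb x (by linarith), hφb, hder, fun y hy => key y (by linarith)⟩

/-! ### Smooth kernels and quadratic forms of increments -/

section PartialDerivative

variable {E F : Type*} [NormedAddCommGroup E] [NormedSpace ℝ E] [NormedAddCommGroup F]
  [NormedSpace ℝ F]

/-- The partial derivative with respect to the first variable. -/
noncomputable def fderivFst (G : E × E → F) (p : E × E) : E →L[ℝ] F :=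
  (fderiv ℝ G p).comp (ContinuousLinearMap.inl ℝ E E)

/-- The partial derivative with respect to the second variable. -/
noncomputable def fderivSnd (G : E × E → F) (p : E × E) : E →L[ℝ] F :=
  (fderiv ℝ G p).comp (ContinuousLinearMap.inr ℝ E E)

lemma hasFDerivAt_fderivFst {G : E × E → F} (hG : Differentiable ℝ G) (x y : E) :
    HasFDerivAt (fun x => G (x, y)) (fderivFst G (x, y)) x :=
  (hG (x, y)).hasFDerivAt.comp x (hasFDerivAt_prodMk_left x y)

lemma hasFDerivAt_fderivSnd {G : E × E → F} (hG : Differentiable ℝ G) (x y : E) :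
    HasFDerivAt (fun y => G (x, y)) (fderivSnd G (x, y)) y :=
  (hG (x, y)).hasFDerivAt.comp y (hasFDerivAt_prodMk_right x y)

lemma ContDiff.fderivFst {G : E × E → F} {n m : WithTop ℕ∞} (hG : ContDiff ℝ n G)
    (h : m + 1 ≤ n) : ContDiff ℝ m (fderivFst G) :=
  (hG.fderiv_right h).clm_comp contDiff_const

lemma ContDiff.fderivSnd {G : E × E → F} {n m : WithTop ℕ∞} (hG : ContDiff ℝ n G)
    (h : m + 1 ≤ n) : ContDiff ℝ m (fderivSnd G) :=
  (hG.fderiv_right h).clm_comp contDiff_const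

/-- A continuously differentiable function is bounded and Lipschitz on a compact convex set. -/
lemma ContDiff.exists_bound_lipschitz {G : E → F} (hG : ContDiff ℝ 1 G) {s : Set E}
    (hs : IsCompact s) (hc : Convex ℝ s) :
    ∃ M, 0 ≤ M ∧ (∀ p ∈ s, ‖G p‖ ≤ M) ∧ ∀ p ∈ s, ∀ q ∈ s, ‖G p - G q‖ ≤ M * ‖p - q‖ := by
  obtain ⟨M₁, h₁⟩ := hs.exists_bound_of_continuousOn hG.continuous.continuousOn
  obtain ⟨M₂, h₂⟩ := hs.exists_bound_of_continuousOn
    (hG.continuous_fderiv one_ne_zero).continuousOn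
  refine ⟨max (max M₁ M₂) 0, le_max_right _ _,
    fun p hp => (h₁ p hp).trans ((le_max_left _ _).trans (le_max_left _ _)), fun p hp q hq => ?_⟩
  exact hc.norm_image_sub_le_of_norm_fderiv_le (fun x _ => hG.differentiable one_ne_zero x)
    (fun x hx => (h₂ x hx).trans ((le_max_right _ _).trans (le_max_left _ _))) hq hp

/-- First order Taylor estimate for a finite combination of increments. -/
lemma norm_sum_increments_le {φ : E → F} {s : E} {M : ℝ} {φ' : E → E →L[ℝ] F}
    (hφ : ∀ x, HasFDerivAt φ (φ' x) x) (hM : 0 ≤ M)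
    (h0 : ‖φ' s‖ ≤ M) (h1 : ∀ x, ‖x - s‖ ≤ 1 → ‖φ' x - φ' s‖ ≤ M * ‖x - s‖)
    {ι : Type*} (I : Finset ι) (a : ι → ℝ) (d : ι → E) (hd : ∀ i ∈ I, ‖d i‖ ≤ 1) :
    ‖∑ i ∈ I, a i • (φ (s + d i) - φ s)‖ ≤
      M * (‖∑ i ∈ I, a i • d i‖ + ∑ i ∈ I, |a i| * ‖d i‖ ^ 2) := by
  have key : ∀ i ∈ I, ‖φ (s + d i) - φ s - φ' s (d i)‖ ≤ M * ‖d i‖ ^ 2 := fun i hi => by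
    have := (convex_closedBall s ‖d i‖).norm_image_sub_le_of_norm_hasFDerivWithin_le'
      (f := φ) (f' := φ') (φ := φ' s) (C := M * ‖d i‖) (x := s) (y := s + d i)
      (fun x _ => (hφ x).hasFDerivWithinAt) (fun x hx => by
        rw [mem_closedBall_iff_norm] at hx
        exact (h1 x (hx.trans (hd i hi))).trans (by gcongr)) (by simp) (by simp)
    simp only [add_sub_cancel_left] at this
    exact this.trans (le_of_eq (by ring))
  have e : ∑ i ∈ I, a i • (φ (s + d i) - φ s) = φ' s (∑ i ∈ I, a i • d i) +
      ∑ i ∈ I, a i • (φ (s + d i) - φ s - φ' s (d i)) := by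
    rw [map_sum, ← Finset.sum_add_distrib]
    refine Finset.sum_congr rfl fun i _ => ?_
    rw [map_smul, ← smul_add, add_sub_cancel]
  rw [e, mul_add]
  refine (norm_add_le _ _).trans (add_le_add ?_ ?_)
  · exact ((φ' s).le_opNorm _).trans (by gcongr)
  · rw [Finset.mul_sum]
    refine (norm_sum_le _ _).trans (Finset.sum_le_sum fun i hi => ?_)
    rw [norm_smul, Real.norm_eq_abs]
    calc _ ≤ |a i| * (M * ‖d i‖ ^ 2) := by gcongr; exact key i hi
      _ = _ := by ring

/-- Estimate of the quadratic form of increments attached to a smooth kernel. -/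
lemma exists_abs_sum_sum_kernel_le [FiniteDimensional ℝ E] {K : E × E → ℝ} (hK : ContDiff ℝ 4 K)
    (s : E) :
    ∃ A, 0 ≤ A ∧ ∀ {ι : Type*} (I : Finset ι) (a : ι → ℝ) (d : ι → E), (∀ i ∈ I, ‖d i‖ ≤ 1) →
      |∑ j ∈ I, ∑ i ∈ I, a j * (a i * (K (s + d j, s + d i) - K (s + d j, s) - K (s, s + d i)
        + K (s, s)))| ≤ A * (‖∑ i ∈ I, a i • d i‖ + ∑ i ∈ I, |a i| * ‖d i‖ ^ 2) ^ 2 := by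
  have : ProperSpace E := FiniteDimensional.proper ℝ E
  have hK1 : ContDiff ℝ 3 (fderivFst K) := hK.fderivFst (by norm_num)
  have hK2 : ContDiff ℝ 2 (fderivSnd (fderivFst K)) := hK1.fderivSnd (by norm_num)
  have hK3 : ContDiff ℝ 1 (fderivFst (fderivSnd (fderivFst K))) := hK2.fderivFst (by norm_num)
  obtain ⟨M₂, hM₂, hb₂, hl₂⟩ := (hK2.of_le (by norm_num)).exists_bound_lipschitz
    (isCompact_closedBall ((s, s) : E × E) 1) (convex_closedBall _ _)
  obtain ⟨M₃, hM₃, hb₃, hl₃⟩ := hK3.exists_bound_lipschitz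
    (isCompact_closedBall ((s, s) : E × E) 1) (convex_closedBall _ _)
  have hmem : ∀ x y : E, ‖x - s‖ ≤ 1 → ‖y - s‖ ≤ 1 → (x, y) ∈ Metric.closedBall (s, s) 1 :=
    fun x y hx hy => by
      rw [mem_closedBall_iff_norm, Prod.mk_sub_mk, Prod.norm_mk]; exact max_le hx hy
  have hss : ‖s - s‖ ≤ 1 := by simp
  set M := max M₂ M₃
  have hM : 0 ≤ M := hM₂.trans (le_max_left _ _)
  refine ⟨M, hM, fun I a d hd => ?_⟩
  set ε := ‖∑ i ∈ I, a i • d i‖ + ∑ i ∈ I, |a i| * ‖d i‖ ^ 2 with hε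
  have hε0 : 0 ≤ ε := by positivity
  have e1 : ∑ j ∈ I, ∑ i ∈ I, a j * (a i * (K (s + d j, s + d i) - K (s + d j, s) - K (s, s + d i)
        + K (s, s))) = ∑ j ∈ I, a j • ((fun x => ∑ i ∈ I, a i • (K (x, s + d i) - K (x, s))) (s + d j)
        - (fun x => ∑ i ∈ I, a i • (K (x, s + d i) - K (x, s))) s) := by
    refine Finset.sum_congr rfl fun j _ => ?_
    simp only [← Finset.sum_sub_distrib, smul_eq_mul, Finset.mul_sum]
    refine Finset.sum_congr rfl fun i _ => ?_
    ring
  rw [e1, ← Real.norm_eq_abs]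
  have hdiff : Differentiable ℝ K := hK.differentiable (by norm_num)
  have hdiff1 : Differentiable ℝ (fderivFst K) := hK1.differentiable (by norm_num)
  have hdiff2 : Differentiable ℝ (fderivSnd (fderivFst K)) := hK2.differentiable (by norm_num)
  -- The first order estimate is used twice. The double sum is a combination of increments of `x ↦ ∑
  -- a i • (K (x, s + d i) - K (x, s))`, and the bounds on the derivative of this map come from the
  -- same estimate in the second variable. Each use contributes one factor `ε`.
  have hb := norm_sum_increments_le (F := ℝ) (s := s) (M := M * ε)
    (φ := fun x => ∑ i ∈ I, a i • (K (x, s + d i) - K (x, s)))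
    (φ' := fun x => ∑ i ∈ I, a i • (fderivFst K (x, s + d i) - fderivFst K (x, s)))
    (fun x => HasFDerivAt.fun_sum fun i _ => ((hasFDerivAt_fderivFst hdiff x (s + d i)).sub
      (hasFDerivAt_fderivFst hdiff x s)).const_smul (a i)) (by positivity) ?_ ?_ I a d hd
  · refine hb.trans (le_of_eq ?_)
    rw [← hε]; ring
  · refine norm_sum_increments_le (φ := fun y => fderivFst K (s, y))
      (φ' := fun y => fderivSnd (fderivFst K) (s, y))
      (fun y => hasFDerivAt_fderivSnd hdiff1 s y) hM ?_ ?_ I a d hd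
    · exact (hb₂ _ (hmem s s hss hss)).trans (le_max_left _ _)
    · intro y hy
      refine (hl₂ _ (hmem s y hss hy) _ (hmem s s hss hss)).trans ?_
      rw [Prod.mk_sub_mk, Prod.norm_mk, sub_self, norm_zero, max_eq_right (norm_nonneg _)]
      gcongr; exact le_max_left _ _
  · intro x hx
    have e2 : ∑ i ∈ I, a i • (fderivFst K (x, s + d i) - fderivFst K (x, s)) -
        ∑ i ∈ I, a i • (fderivFst K (s, s + d i) - fderivFst K (s, s)) =
        ∑ i ∈ I, a i • ((fun y => fderivFst K (x, y) - fderivFst K (s, y)) (s + d i) -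
          (fun y => fderivFst K (x, y) - fderivFst K (s, y)) s) := by
      rw [← Finset.sum_sub_distrib]
      refine Finset.sum_congr rfl fun i _ => ?_
      rw [← smul_sub]; congr 1; simp only; abel
    rw [e2]
    have := norm_sum_increments_le (s := s) (M := M * ‖x - s‖)
      (φ := fun y => fderivFst K (x, y) - fderivFst K (s, y))
      (φ' := fun y => fderivSnd (fderivFst K) (x, y) - fderivSnd (fderivFst K) (s, y))
      (fun y => (hasFDerivAt_fderivSnd hdiff1 x y).sub (hasFDerivAt_fderivSnd hdiff1 s y))
      (by positivity) ?_ ?_ I a d hd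
    · refine this.trans (le_of_eq ?_)
      rw [← hε]; ring
    · refine (hl₂ _ (hmem x s hx hss) _ (hmem s s hss hss)).trans ?_
      rw [Prod.mk_sub_mk, Prod.norm_mk, sub_self, norm_zero, max_eq_left (norm_nonneg _)]
      gcongr; exact le_max_left _ _
    · intro y hy
      -- Mean value inequality in the first variable; the third mixed derivative is Lipschitz, which
      -- supplies the factor `‖y - s‖`.
      have := (convex_closedBall s 1).norm_image_sub_le_of_norm_hasFDerivWithin_le
        (f := fun x => fderivSnd (fderivFst K) (x, y) - fderivSnd (fderivFst K) (x, s))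
        (f' := fun x => fderivFst (fderivSnd (fderivFst K)) (x, y) -
          fderivFst (fderivSnd (fderivFst K)) (x, s)) (C := M * ‖y - s‖) (x := s) (y := x)
        (fun z _ => ((hasFDerivAt_fderivFst hdiff2 z y).sub
          (hasFDerivAt_fderivFst hdiff2 z s)).hasFDerivWithinAt) (fun z hz => by
          rw [mem_closedBall_iff_norm] at hz
          refine (hl₃ _ (hmem z y hz hy) _ (hmem z s hz hss)).trans ?_
          rw [Prod.mk_sub_mk, Prod.norm_mk, sub_self, norm_zero, max_eq_right (norm_nonneg _)]
          gcongr; exact le_max_right _ _) (by simp) (by rwa [mem_closedBall_iff_norm])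
      calc _ = _ := by congr 1; abel
        _ ≤ _ := this
        _ = _ := by ring

end PartialDerivative

/-! ### Derivatives along a set of a Hilbert space valued map -/

section MeanSquare

variable {E H : Type*} [NormedAddCommGroup E] [NormedSpace ℝ E] [NormedAddCommGroup H]
  [InnerProductSpace ℝ H]

/-- `η` is a derivative at `s` in the direction `y` of the curve `ζ` on `S`, quantitatively with
respect to all finite combinations of increments of length at most one. -/
def IsIncrementLimit (S : Set E) (ζ : E → H) (s : E) (A : ℝ) (y : E) (η : H) : Prop :=
  ∀ a : {d : E // s + d ∈ S ∧ ‖d‖ ≤ 1} →₀ ℝ,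
    ‖a.sum (fun d c => c • (ζ (s + d) - ζ s)) - η‖ ≤
      A * (‖a.sum (fun d c => c • (d : E)) - y‖ + a.sum (fun d c => |c| * ‖(d : E)‖ ^ 2))

/-- The vector `y` is approximated by finite combinations of increments in `S` at `s`. -/
def IsIncrementApprox (S : Set E) (s : E) (y : E) : Prop :=
  ∀ ε > 0, ∃ a : {d : E // s + d ∈ S ∧ ‖d‖ ≤ 1} →₀ ℝ,
    ‖a.sum (fun d c => c • (d : E)) - y‖ ≤ ε ∧ a.sum (fun d c => |c| * ‖(d : E)‖ ^ 2) ≤ ε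

variable {D : Type*}

lemma Finsupp.sum_abs_mul_add_le (w : D → ℝ) (hw : ∀ d, 0 ≤ w d) (a b : D →₀ ℝ) :
    (a + b).sum (fun d c => |c| * w d) ≤
      a.sum (fun d c => |c| * w d) + b.sum (fun d c => |c| * w d) := by
  classical
  rw [Finsupp.sum_of_support_subset (a + b) Finsupp.support_add _ (by simp),
    Finsupp.sum_of_support_subset a (Finset.subset_union_left (s₂ := b.support)) _ (by simp),
    Finsupp.sum_of_support_subset b (Finset.subset_union_right (s₁ := a.support)) _ (by simp),
    ← Finset.sum_add_distrib]
  refine Finset.sum_le_sum fun d _ => ?_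
  rw [← add_mul]
  exact mul_le_mul_of_nonneg_right (abs_add_le _ _) (hw d)

lemma Finsupp.sum_abs_mul_smul (w : D → ℝ) (r : ℝ) (a : D →₀ ℝ) :
    (r • a).sum (fun d c => |c| * w d) = |r| * a.sum (fun d c => |c| * w d) := by
  rw [Finsupp.sum_smul_index (by simp), Finsupp.mul_sum]
  simp [abs_mul, mul_assoc]

lemma Finsupp.sum_smul_add' {V : Type*} [AddCommGroup V] [Module ℝ V] (v : D → V)
    (a b : D →₀ ℝ) : (a + b).sum (fun d c => c • v d) =
      a.sum (fun d c => c • v d) + b.sum (fun d c => c • v d) :=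
  Finsupp.sum_add_index' (by simp) (fun _ _ _ => add_smul _ _ _)

lemma Finsupp.sum_smul_smul' {V : Type*} [AddCommGroup V] [Module ℝ V] (v : D → V)
    (r : ℝ) (a : D →₀ ℝ) : (r • a).sum (fun d c => c • v d) = r • a.sum (fun d c => c • v d) := by
  rw [Finsupp.sum_smul_index (by simp), Finsupp.smul_sum]
  simp [mul_smul]

lemma IsIncrementApprox.add {S : Set E} {s y z : E} (hy : IsIncrementApprox S s y)
    (hz : IsIncrementApprox S s z) : IsIncrementApprox S s (y + z) := by
  intro ε hε
  obtain ⟨a, ha, ha'⟩ := hy (ε / 2) (by positivity)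
  obtain ⟨b, hb, hb'⟩ := hz (ε / 2) (by positivity)
  refine ⟨a + b, ?_, ?_⟩
  · rw [Finsupp.sum_smul_add', add_sub_add_comm]
    exact (norm_add_le _ _).trans (by linarith)
  · exact (Finsupp.sum_abs_mul_add_le _ (fun _ => by positivity) a b).trans (by linarith)

lemma IsIncrementApprox.smul {S : Set E} {s y : E} (hy : IsIncrementApprox S s y) (r : ℝ) :
    IsIncrementApprox S s (r • y) := by
  intro ε hε
  obtain ⟨a, ha, ha'⟩ := hy (ε / (|r| + 1)) (by positivity)
  have h1 : |r| * (ε / (|r| + 1)) ≤ ε := by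
    rw [mul_div_assoc', div_le_iff₀ (by positivity)]; nlinarith
  refine ⟨r • a, ?_, ?_⟩
  · rw [Finsupp.sum_smul_smul', ← smul_sub, norm_smul, Real.norm_eq_abs]
    exact (mul_le_mul_of_nonneg_left ha (abs_nonneg r)).trans h1
  · rw [Finsupp.sum_abs_mul_smul]
    exact (mul_le_mul_of_nonneg_left ha' (abs_nonneg r)).trans h1

/-- A tangent vector is a limit of `c • d` with `d → 0`, so one term suffices: `|c| * ‖d‖ ^ 2` is
the bounded quantity `‖c • d‖` times `‖d‖ → 0`. -/
lemma isIncrementApprox_of_mem_tangentConeAt {S : Set E} {s y : E}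
    (hy : y ∈ tangentConeAt ℝ S s) : IsIncrementApprox S s y := by
  obtain ⟨α, l, hl, c, d, hd, hS, hcd⟩ := exists_fun_of_mem_tangentConeAt hy
  intro ε hε
  have h1 : ∀ᶠ n in l, ‖d n‖ ≤ 1 := by
    filter_upwards [hd.norm.eventually_le_const (u := 1) (by simp)] with n hn using hn
  have h2 : ∀ᶠ n in l, ‖c n • d n - y‖ ≤ ε := by
    filter_upwards [(hcd.sub_const y).norm.eventually_le_const (u := ε) (by simpa using hε)]
      with n hn using hn
  have h3 : ∀ᶠ n in l, |c n| * ‖d n‖ ^ 2 ≤ ε := by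
    have : Tendsto (fun n => ‖c n • d n‖ * ‖d n‖) l (𝓝 (‖y‖ * ‖(0 : E)‖)) := hcd.norm.mul hd.norm
    filter_upwards [this.eventually_le_const (u := ε) (by simpa using hε)] with n hn
    rw [norm_smul, Real.norm_eq_abs] at hn
    linarith [show |c n| * ‖d n‖ ^ 2 = |c n| * ‖d n‖ * ‖d n‖ by ring]
  obtain ⟨n, a1, a2, a3, a4⟩ := (h1.and (hS.and (h2.and h3))).exists
  refine ⟨Finsupp.single ⟨d n, a2, a1⟩ (c n), ?_, ?_⟩
  · rw [Finsupp.sum_single_index (by simp)]; exact a3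
  · rw [Finsupp.sum_single_index (by simp)]; exact a4

lemma UniqueDiffWithinAt.isIncrementApprox {S : Set E} {s : E} (h : UniqueDiffWithinAt ℝ S s)
    (y : E) : IsIncrementApprox S s y := by
  have hspan : ∀ z ∈ Submodule.span ℝ (tangentConeAt ℝ S s), IsIncrementApprox S s z := by
    intro z hz
    induction hz using Submodule.span_induction with
    | mem x hx => exact isIncrementApprox_of_mem_tangentConeAt hx
    | zero => exact fun ε hε => ⟨0, by simpa using hε.le, by simpa using hε.le⟩
    | add x y _ _ hx hy => exact hx.add hy
    | smul r x _ hx => exact hx.smul r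
  intro ε hε
  obtain ⟨z, hz, hyz⟩ := Metric.mem_closure_iff.1 (h.dense_tangentConeAt y) (ε / 2) (by positivity)
  obtain ⟨a, ha, ha'⟩ := hspan z hz (ε / 2) (by positivity)
  refine ⟨a, ?_, by linarith⟩
  rw [dist_comm, dist_eq_norm] at hyz
  calc _ = ‖(a.sum (fun d c => c • (d : E)) - z) + (z - y)‖ := by congr 1; abel
    _ ≤ _ := (norm_add_le _ _).trans (by linarith)

/-- Combinations `b` and `c` nearly realizing `y` and `z` serve as intermediaries: `h0` for `a - (b
+ c)` compares `a` with them, and `hy`, `hz` replace them by `η`, `θ`. The total loss is `8 * A *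
δ`. -/
lemma IsIncrementLimit.add_of_approx {S : Set E} {ζ : E → H} {s : E} {A : ℝ} {y z : E} {η θ : H}
    (hA : 0 ≤ A) (h0 : IsIncrementLimit S ζ s A 0 0)
    (hy : IsIncrementLimit S ζ s A y η) (hz : IsIncrementLimit S ζ s A z θ)
    (hy' : IsIncrementApprox S s y) (hz' : IsIncrementApprox S s z) :
    IsIncrementLimit S ζ s A (y + z) (η + θ) := by
  intro a
  refine le_of_forall_pos_le_add fun ε hε => ?_
  set δ := ε / (8 * (A + 1)) with hδ
  have hδ0 : 0 < δ := by positivity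
  have hδε : 8 * (A * δ) ≤ ε := by
    rw [hδ, mul_div_assoc', mul_div_assoc', div_le_iff₀ (by positivity)]; nlinarith
  obtain ⟨b, hb, hb'⟩ := hy' δ hδ0
  obtain ⟨c, hc, hc'⟩ := hz' δ hδ0
  have h1 := h0 (a + (-1 : ℝ) • (b + c))
  have h2 := hy b
  have h3 := hz c
  simp only [Finsupp.sum_smul_add', Finsupp.sum_smul_smul', sub_zero] at h1
  have h4 := Finsupp.sum_abs_mul_add_le
    (fun d : {d : E // s + d ∈ S ∧ ‖d‖ ≤ 1} => ‖(d : E)‖ ^ 2) (fun _ => by positivity) a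
    ((-1 : ℝ) • (b + c))
  rw [Finsupp.sum_abs_mul_smul] at h4
  have h5 := Finsupp.sum_abs_mul_add_le
    (fun d : {d : E // s + d ∈ S ∧ ‖d‖ ≤ 1} => ‖(d : E)‖ ^ 2) (fun _ => by positivity) b c
  simp only [abs_neg, abs_one, one_mul, neg_smul, one_smul] at h1 h4
  set Ta := a.sum (fun d c => c • (ζ (s + d) - ζ s))
  set Tb := b.sum (fun d c => c • (ζ (s + d) - ζ s))
  set Tc := c.sum (fun d c => c • (ζ (s + d) - ζ s))
  set Ba := a.sum (fun d c => c • (d : E))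
  set Bb := b.sum (fun d c => c • (d : E))
  set Bc := c.sum (fun d c => c • (d : E))
  have e1 : ‖Ta - (η + θ)‖ ≤ ‖Ta + -(Tb + Tc)‖ + ‖Tb - η‖ + ‖Tc - θ‖ := by
    have : Ta - (η + θ) = (Ta + -(Tb + Tc)) + (Tb - η) + (Tc - θ) := by abel
    rw [this]; exact norm_add₃_le
  have e2 : ‖Ba + -(Bb + Bc)‖ ≤ ‖Ba - (y + z)‖ + ‖Bb - y‖ + ‖Bc - z‖ := by
    have : Ba + -(Bb + Bc) = (Ba - (y + z)) - (Bb - y) - (Bc - z) := by abel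
    rw [this]
    exact (norm_sub_le _ _).trans (by gcongr; exact norm_sub_le _ _)
  set ra := a.sum (fun d c => |c| * ‖(d : E)‖ ^ 2)
  have f1 := h1.trans (mul_le_mul_of_nonneg_left (add_le_add e2 h4) hA)
  have g1 : A * (‖Ba - (y + z)‖ + ‖Bb - y‖ + ‖Bc - z‖ + (ra +
      (b + c).sum (fun d c => |c| * ‖(d : E)‖ ^ 2))) ≤
      A * (‖Ba - (y + z)‖ + δ + δ + (ra + (δ + δ))) := by gcongr; linarith
  have g2 := h2.trans (mul_le_mul_of_nonneg_left (add_le_add hb hb') hA)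
  have g3 := h3.trans (mul_le_mul_of_nonneg_left (add_le_add hc hc') hA)
  calc _ ≤ _ := e1
    _ ≤ A * (‖Ba - (y + z)‖ + δ + δ + (ra + (δ + δ))) + A * (δ + δ) + A * (δ + δ) := by
      gcongr; exact f1.trans g1
    _ = A * (‖Ba - (y + z)‖ + ra) + 8 * (A * δ) := by ring
    _ ≤ _ := by gcongr

lemma IsIncrementLimit.smul {S : Set E} {ζ : E → H} {s : E} {A : ℝ} {y : E} {η : H}
    (h0 : IsIncrementLimit S ζ s A 0 0)
    (hy : IsIncrementLimit S ζ s A y η) (r : ℝ) :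
    IsIncrementLimit S ζ s A (r • y) (r • η) := by
  rcases eq_or_ne r 0 with rfl | hr
  · simpa using h0
  intro a
  have h := hy (r⁻¹ • a)
  rw [Finsupp.sum_smul_smul', Finsupp.sum_smul_smul', Finsupp.sum_abs_mul_smul] at h
  have e1 : a.sum (fun d c => c • (ζ (s + d) - ζ s)) - r • η =
      r • (r⁻¹ • a.sum (fun d c => c • (ζ (s + d) - ζ s)) - η) := by
    rw [smul_sub, smul_inv_smul₀ hr]
  have e2 : a.sum (fun d c => c • (d : E)) - r • y =
      r • (r⁻¹ • a.sum (fun d c => c • (d : E)) - y) := by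
    rw [smul_sub, smul_inv_smul₀ hr]
  rw [e1, e2, norm_smul, norm_smul, Real.norm_eq_abs]
  refine (mul_le_mul_of_nonneg_left h (abs_nonneg r)).trans (le_of_eq ?_)
  rw [abs_inv]
  have : |r| ≠ 0 := abs_ne_zero.2 hr
  field_simp

/-- By `h0`, two combinations of increments whose base vectors are both close to `y` have close
values. Hence approximating combinations form a Cauchy sequence, and its limit is `η`. -/
lemma IsIncrementLimit.exists_of_approx [CompleteSpace H] {S : Set E} {ζ : E → H} {s : E} {A : ℝ}
    {y : E} (hA : 0 ≤ A) (h0 : IsIncrementLimit S ζ s A 0 0) (hy : IsIncrementApprox S s y) :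
    ∃ η, IsIncrementLimit S ζ s A y η := by
  choose b hb hb' using fun n : ℕ => hy (1 / (n + 1)) (by positivity)
  have hdiff : ∀ a c : {d : E // s + d ∈ S ∧ ‖d‖ ≤ 1} →₀ ℝ,
      ‖a.sum (fun d c => c • (ζ (s + d) - ζ s)) - c.sum (fun d c => c • (ζ (s + d) - ζ s))‖ ≤
      A * ((‖a.sum (fun d c => c • (d : E)) - y‖ + ‖c.sum (fun d c => c • (d : E)) - y‖) +
        (a.sum (fun d c => |c| * ‖(d : E)‖ ^ 2) + c.sum (fun d c => |c| * ‖(d : E)‖ ^ 2))) := by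
    intro a c
    have h1 := h0 (a + (-1 : ℝ) • c)
    have h4 := Finsupp.sum_abs_mul_add_le
      (fun d : {d : E // s + d ∈ S ∧ ‖d‖ ≤ 1} => ‖(d : E)‖ ^ 2) (fun _ => by positivity) a
      ((-1 : ℝ) • c)
    rw [Finsupp.sum_abs_mul_smul] at h4
    simp only [Finsupp.sum_smul_add', Finsupp.sum_smul_smul', sub_zero] at h1
    simp only [abs_neg, abs_one, one_mul, neg_smul, one_smul, ← sub_eq_add_neg] at h1 h4
    refine h1.trans (mul_le_mul_of_nonneg_left (add_le_add ?_ h4) hA)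
    calc _ = ‖(a.sum (fun d c => c • (d : E)) - y) - (c.sum (fun d c => c • (d : E)) - y)‖ := by
          congr 1; abel
      _ ≤ _ := norm_sub_le _ _
  have hu : Tendsto (fun n : ℕ => (1 : ℝ) / (n + 1)) atTop (𝓝 0) :=
    tendsto_one_div_add_atTop_nhds_zero_nat
  have hcauchy : CauchySeq (fun n => (b n).sum (fun d c => c • (ζ (s + d) - ζ s))) := by
    refine cauchySeq_of_le_tendsto_0 (fun n : ℕ => A * (4 * (1 / (n + 1)))) (fun n m N hn hm => ?_)
      (by simpa using (hu.const_mul 4).const_mul A)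
    rw [dist_eq_norm]
    refine (hdiff (b n) (b m)).trans (mul_le_mul_of_nonneg_left ?_ hA)
    have i1 : (1 : ℝ) / (n + 1) ≤ 1 / (N + 1) := by gcongr
    have i2 : (1 : ℝ) / (m + 1) ≤ 1 / (N + 1) := by gcongr
    linarith [hb n, hb m, hb' n, hb' m]
  obtain ⟨η, hη⟩ := cauchySeq_tendsto_of_complete hcauchy
  refine ⟨η, fun a => ?_⟩
  refine le_of_tendsto_of_tendsto (tendsto_const_nhds.sub hη).norm
    (b := atTop) (g := fun n : ℕ => A * ((‖a.sum (fun d c => c • (d : E)) - y‖ + 1 / (n + 1)) +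
      (a.sum (fun d c => |c| * ‖(d : E)‖ ^ 2) + 1 / (n + 1)))) ?_ (Eventually.of_forall fun n => ?_)
  · simpa using ((hu.const_add ‖a.sum (fun d c => c • (d : E)) - y‖).add
      (hu.const_add (a.sum (fun d c => |c| * ‖(d : E)‖ ^ 2)))).const_mul A
  · refine (hdiff a (b n)).trans (mul_le_mul_of_nonneg_left ?_ hA)
    linarith [hb n, hb' n]

/-- A Hilbert space valued map whose Gram kernel is four times continuously differentiable is
differentiable along `S`, with a quadratic remainder. -/
theorem exists_derivatives_of_contDiff_kernel [FiniteDimensional ℝ E] [CompleteSpace H] {S : Set E}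
    {ζ : E → H} {K : E × E → ℝ} (hK : ContDiff ℝ 4 K)
    (hζ : ∀ x ∈ S, ∀ y ∈ S, inner ℝ (ζ x) (ζ y) = K (x, y)) {s : E} (hs : s ∈ S)
    (hS : UniqueDiffWithinAt ℝ S s) (e : Fin 2 → E) :
    ∃ (η : Fin 2 → H) (A : ℝ), 0 ≤ A ∧ ∀ (v : Fin 2 → ℝ), ∀ t ∈ S, ‖t - s‖ ≤ 1 →
      t - s = ∑ i, v i • e i → ‖ζ t - ζ s - ∑ i, v i • η i‖ ≤ A * ‖t - s‖ ^ 2 := by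
  obtain ⟨A, hA, hAK⟩ := exists_abs_sum_sum_kernel_le hK s
  -- The squared norm of a combination of increments of `ζ` is exactly the quadratic form in the
  -- kernel bounded by `hAK`.
  have h0 : IsIncrementLimit S ζ s (Real.sqrt A) 0 0 := by
    intro a
    rw [sub_zero, sub_zero]
    have h1 := hAK a.support a (fun d => (d : E)) (fun d _ => d.2.2)
    have e : ‖a.sum (fun d c => c • (ζ (s + d) - ζ s))‖ ^ 2 =
        ∑ j ∈ a.support, ∑ i ∈ a.support, a j * (a i * (K (s + j, s + i) - K (s + j, s)
          - K (s, s + i) + K (s, s))) := by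
      rw [← real_inner_self_eq_norm_sq, Finsupp.sum, sum_inner]
      refine Finset.sum_congr rfl fun j _ => ?_
      rw [inner_sum]
      refine Finset.sum_congr rfl fun i _ => ?_
      rw [real_inner_smul_left, real_inner_smul_right, inner_sub_left, inner_sub_right,
        inner_sub_right, hζ _ j.2.1 _ i.2.1, hζ _ j.2.1 _ hs, hζ _ hs _ i.2.1, hζ _ hs _ hs]
      ring
    rw [← e, abs_of_nonneg (sq_nonneg _)] at h1
    have h2 := Real.sqrt_le_sqrt h1
    rwa [Real.sqrt_sq (norm_nonneg _), Real.sqrt_mul hA, Real.sqrt_sq (by positivity)] at h2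
  have hA' := Real.sqrt_nonneg A
  choose η hη using fun i : Fin 2 => h0.exists_of_approx hA'
    (hS.isIncrementApprox (e i))
  refine ⟨η, Real.sqrt A, hA', fun v t ht hts hv => ?_⟩
  have h1 := IsIncrementLimit.add_of_approx hA' h0 (h0.smul (hη 0) (v 0))
    (h0.smul (hη 1) (v 1)) (hS.isIncrementApprox _) (hS.isIncrementApprox _)
  -- For the single increment `t - s` with coefficient one the linear defect vanishes, and only the
  -- quadratic term remains.
  have h2 := h1 (Finsupp.single ⟨t - s, by simpa using ht, hts⟩ 1)
  rw [Fin.sum_univ_two] at hv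
  rw [← hv] at h2
  simpa [Fin.sum_univ_two] using h2

/-- A Hilbert space valued map on the plane whose Gram kernel is four times continuously
differentiable has a gradient along `S`, with a quadratic remainder. -/
theorem exists_gradient_of_contDiff_kernel [CompleteSpace H] {S : Set Plane} {ζ : Plane → H}
    {K : Plane × Plane → ℝ} (hK : ContDiff ℝ 4 K)
    (hζ : ∀ x ∈ S, ∀ y ∈ S, inner ℝ (ζ x) (ζ y) = K (x, y)) {s : Plane} (hs : s ∈ S)
    (hS : UniqueDiffWithinAt ℝ S s) :
    ∃ (η : Fin 2 → H) (A : ℝ), 0 ≤ A ∧ ∀ t ∈ S, ‖t - s‖ ≤ 1 →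
      ‖ζ t - ζ s - ∑ i, (t i - s i) • η i‖ ≤ A * ‖t - s‖ ^ 2 := by
  obtain ⟨η, A, hA, h⟩ := exists_derivatives_of_contDiff_kernel hK hζ hs hS
    (fun i => EuclideanSpace.single i (1 : ℝ))
  refine ⟨η, A, hA, fun t ht hts => h (fun i => t i - s i) t ht hts ?_⟩
  ext i
  fin_cases i <;> simp [Fin.sum_univ_two]

end MeanSquare

/-! ### Second differences and the mixed fourth derivative of the covariance -/

section SecondDifference

/-- Mean value theorem for second differences. -/
lemma exists_secondDiff_eq {q q' q'' : ℝ → ℝ} (h1 : ∀ x, HasDerivAt q (q' x) x)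
    (h2 : ∀ x, HasDerivAt q' (q'' x) x) {h : ℝ} (hh : 0 < h) (x : ℝ) :
    ∃ ξ, |ξ - x| ≤ h ∧ secondDiff q h x = h ^ 2 * q'' ξ := by
  have hp : ∀ t, HasDerivAt (fun t => q (x + t) + q (x - t) - 2 * q x) (q' (x + t) - q' (x - t)) t :=
    fun t => by
    have a1 : HasDerivAt (fun t => q (x + t)) (q' (x + t)) t := by
      simpa using (h1 (x + t)).comp_const_add x t
    have a2 : HasDerivAt (fun t => q (x - t)) (-q' (x - t)) t := by
      simpa using (h1 (x - t)).comp_const_sub x t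
    simpa [sub_eq_add_neg] using (a1.add a2).sub_const (2 * q x)
  have hs : ∀ t : ℝ, HasDerivAt (fun t : ℝ => t ^ 2) (2 * t) t := fun t => by
    simpa using hasDerivAt_pow 2 t
  -- Cauchy's mean value theorem, comparing the symmetrized function with `t ^ 2`; a second mean
  -- value theorem for `q'` on `[x - t, x + t]` follows.
  obtain ⟨t, ht, e1⟩ := exists_ratio_hasDerivAt_eq_ratio_slope _ _ hh
    (fun t _ => (hp t).continuousAt.continuousWithinAt) (fun t _ => hp t) _ _
    (fun t _ => (hs t).continuousAt.continuousWithinAt) (fun t _ => hs t)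
  obtain ⟨ξ, hξ, e2⟩ := exists_hasDerivAt_eq_slope q' q'' (a := x - t) (b := x + t)
    (by linarith [ht.1]) (fun t _ => (h2 t).continuousAt.continuousWithinAt) (fun t _ => h2 t)
  refine ⟨ξ, ?_, ?_⟩
  · rw [abs_le]; constructor <;> linarith [hξ.1, hξ.2, ht.2]
  · have ht0 : t ≠ 0 := ht.1.ne'
    have e3 : q' (x + t) - q' (x - t) = q'' ξ * (2 * t) := by
      rw [e2, show x + t - (x - t) = 2 * t by ring,
        div_mul_cancel₀ _ (mul_ne_zero two_ne_zero ht0)]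
    rw [e3] at e1
    simp only [add_zero, sub_zero] at e1
    unfold secondDiff
    have e4 : (h ^ 2 * q'' ξ) * (2 * t) = (q (x + h) - 2 * q x + q (x - h)) * (2 * t) := by
      linear_combination e1
    exact (mul_right_cancel₀ (by simpa using ht0) e4).symm

/-- The first partial derivative of a function on `ℝ × ℝ`. -/
noncomputable def partialFst (c : ℝ × ℝ → ℝ) (p : ℝ × ℝ) : ℝ := fderiv ℝ c p (1, 0)

/-- The second partial derivative of a function on `ℝ × ℝ`. -/
noncomputable def partialSnd (c : ℝ × ℝ → ℝ) (p : ℝ × ℝ) : ℝ := fderiv ℝ c p (0, 1)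

lemma ContDiff.partialFst {c : ℝ × ℝ → ℝ} {n m : WithTop ℕ∞} (hc : ContDiff ℝ n c)
    (h : m + 1 ≤ n) : ContDiff ℝ m (partialFst c) :=
  (hc.fderiv_right h).clm_apply contDiff_const

lemma ContDiff.partialSnd {c : ℝ × ℝ → ℝ} {n m : WithTop ℕ∞} (hc : ContDiff ℝ n c)
    (h : m + 1 ≤ n) : ContDiff ℝ m (partialSnd c) :=
  (hc.fderiv_right h).clm_apply contDiff_const

lemma hasDerivAt_partialFst {c : ℝ × ℝ → ℝ} (hc : Differentiable ℝ c) (x y : ℝ) :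
    HasDerivAt (fun x => c (x, y)) (partialFst c (x, y)) x := by
  have := (hc (x, y)).hasFDerivAt.comp_hasDerivAt x
    ((hasDerivAt_id x).prodMk (hasDerivAt_const x y))
  exact this

lemma hasDerivAt_partialSnd {c : ℝ × ℝ → ℝ} (hc : Differentiable ℝ c) (x y : ℝ) :
    HasDerivAt (fun y => c (x, y)) (partialSnd c (x, y)) y := by
  have := (hc (x, y)).hasFDerivAt.comp_hasDerivAt y
    ((hasDerivAt_const y x).prodMk (hasDerivAt_id y))
  exact this

/-- The mixed derivative `∂₁² ∂₂² c`. -/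
noncomputable def mixedDeriv (c : ℝ × ℝ → ℝ) : ℝ × ℝ → ℝ :=
  partialFst (partialFst (partialSnd (partialSnd c)))

lemma ContDiff.continuous_mixedDeriv {c : ℝ × ℝ → ℝ} (hc : ContDiff ℝ 4 c) :
    Continuous (mixedDeriv c) :=
  ((((hc.partialSnd (m := 3) (by norm_num)).partialSnd (m := 2) (by norm_num)).partialFst
    (m := 1) (by norm_num)).partialFst (m := 0) (by norm_num)).continuous

lemma iteratedDeriv_two_eq {q q' q'' : ℝ → ℝ} (h1 : ∀ x, HasDerivAt q (q' x) x)
    (h2 : ∀ x, HasDerivAt q' (q'' x) x) : iteratedDeriv 2 q = q'' := by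
  rw [iteratedDeriv_succ, iteratedDeriv_one]
  have e : deriv q = q' := funext fun x => (h1 x).deriv
  rw [e]
  exact funext fun x => (h2 x).deriv

lemma diagMixedDeriv_two {c : ℝ × ℝ → ℝ} (hc : ContDiff ℝ 4 c) (x : ℝ) :
    diagMixedDeriv c 2 x = mixedDeriv c (x, x) := by
  have hc1 : ContDiff ℝ 3 (partialSnd c) := hc.partialSnd (by norm_num)
  have hc2 : ContDiff ℝ 2 (partialSnd (partialSnd c)) := hc1.partialSnd (by norm_num)
  have hc3 : ContDiff ℝ 1 (partialFst (partialSnd (partialSnd c))) := hc2.partialFst (by norm_num)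
  have e1 : ∀ x₁, iteratedDeriv 2 (fun x₂ => c (x₁, x₂)) x = partialSnd (partialSnd c) (x₁, x) :=
    fun x₁ => by
    rw [iteratedDeriv_two_eq
      (fun y => hasDerivAt_partialSnd (hc.differentiable (by norm_num)) x₁ y)
      (fun y => hasDerivAt_partialSnd (hc1.differentiable (by norm_num)) x₁ y)]
  unfold diagMixedDeriv
  simp only [e1]
  rw [iteratedDeriv_two_eq
    (fun y => hasDerivAt_partialFst (hc2.differentiable (by norm_num)) y x)
    (fun y => hasDerivAt_partialFst (hc3.differentiable (by norm_num)) y x)]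
  rfl

lemma exists_secondDiff_secondDiff_eq {c : ℝ × ℝ → ℝ} (hc : ContDiff ℝ 4 c) {h : ℝ} (hh : 0 < h)
    (x y : ℝ) : ∃ ξ η, |ξ - x| ≤ h ∧ |η - y| ≤ h ∧
      secondDiff (fun x₂ => secondDiff (fun x₁ => c (x₁, x₂)) h x) h y =
        h ^ 4 * mixedDeriv c (ξ, η) := by
  have hc1 : ContDiff ℝ 3 (partialSnd c) := hc.partialSnd (by norm_num)
  have hc2 : ContDiff ℝ 2 (partialSnd (partialSnd c)) := hc1.partialSnd (by norm_num)
  have hc3 : ContDiff ℝ 1 (partialFst (partialSnd (partialSnd c))) := hc2.partialFst (by norm_num)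
  have hd : ∀ {g : ℝ × ℝ → ℝ}, Differentiable ℝ g → ∀ x₂, HasDerivAt
      (fun x₂ => secondDiff (fun x₁ => g (x₁, x₂)) h x)
      (secondDiff (fun x₁ => partialSnd g (x₁, x₂)) h x) x₂ := fun hg x₂ =>
    ((hasDerivAt_partialSnd hg _ x₂).sub ((hasDerivAt_partialSnd hg _ x₂).const_mul 2)).add
      (hasDerivAt_partialSnd hg _ x₂)
  obtain ⟨η, hη, e1⟩ := exists_secondDiff_eq (hd (hc.differentiable (by norm_num)))
    (hd (hc1.differentiable (by norm_num))) hh y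
  obtain ⟨ξ, hξ, e2⟩ := exists_secondDiff_eq
    (fun z => hasDerivAt_partialFst (hc2.differentiable (by norm_num)) z η)
    (fun z => hasDerivAt_partialFst (hc3.differentiable (by norm_num)) z η) hh x
  refine ⟨ξ, η, hξ, hη, ?_⟩
  rw [e1, e2]
  unfold mixedDeriv
  ring

variable {H : Type*} [NormedAddCommGroup H] [InnerProductSpace ℝ H]

lemma inner_secondDiff {ζ : ℝ → H} {c : ℝ × ℝ → ℝ} (hζ : ∀ x y, inner ℝ (ζ x) (ζ y) = c (x, y))
    (h x y : ℝ) :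
    inner ℝ (ζ (x + h) - (2 : ℝ) • ζ x + ζ (x - h)) (ζ (y + h) - (2 : ℝ) • ζ y + ζ (y - h)) =
      secondDiff (fun x₂ => secondDiff (fun x₁ => c (x₁, x₂)) h x) h y := by
  simp only [inner_add_left, inner_add_right, inner_sub_left, inner_sub_right,
    real_inner_smul_left, real_inner_smul_right, hζ, secondDiff]
  ring

/-- This exhibits `mixedDeriv c` as a limit of Gram kernels. It thus inherits positivity on the
diagonal and the Cauchy–Schwarz inequality, without a second derivative of `ζ` being constructed. -/
lemma tendsto_inner_secondDiff {ζ : ℝ → H} {c : ℝ × ℝ → ℝ} (hc : ContDiff ℝ 4 c)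
    (hζ : ∀ x y, inner ℝ (ζ x) (ζ y) = c (x, y)) (x y : ℝ) :
    Tendsto (fun h : ℝ => inner ℝ ((h ^ 2)⁻¹ • (ζ (x + h) - (2 : ℝ) • ζ x + ζ (x - h)))
      ((h ^ 2)⁻¹ • (ζ (y + h) - (2 : ℝ) • ζ y + ζ (y - h)))) (𝓝[>] 0) (𝓝 (mixedDeriv c (x, y))) := by
  rw [Metric.tendsto_nhds]
  intro ε hε
  have := Metric.continuous_iff.1 hc.continuous_mixedDeriv (x, y) ε hε
  obtain ⟨δ, hδ, hδ'⟩ := this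
  filter_upwards [Ioo_mem_nhdsGT hδ] with h hh
  obtain ⟨ξ, η, h1, h2, e⟩ := exists_secondDiff_secondDiff_eq hc hh.1 x y
  rw [real_inner_smul_left, real_inner_smul_right, inner_secondDiff hζ, e]
  have : h ≠ 0 := hh.1.ne'
  have e2 : (h ^ 2)⁻¹ * ((h ^ 2)⁻¹ * (h ^ 4 * mixedDeriv c (ξ, η))) = mixedDeriv c (ξ, η) := by
    field_simp
  rw [e2]
  refine hδ' _ ?_
  rw [Prod.dist_eq, Real.dist_eq, Real.dist_eq]
  exact max_lt (h1.trans_lt hh.2) (h2.trans_lt hh.2)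

/-- If the Gram kernel of a Hilbert space valued curve has a mixed derivative `∂₁² ∂₂²` bounded on
the diagonal, then the second differences of the curve are of quadratic order. -/
theorem norm_secondDiff_le {ζ : ℝ → H} {c : ℝ × ℝ → ℝ} (hc : ContDiff ℝ 4 c)
    (hζ : ∀ x y, inner ℝ (ζ x) (ζ y) = c (x, y)) {B : ℝ} (hB : ∀ x, mixedDeriv c (x, x) ≤ B)
    {h : ℝ} (hh : 0 < h) (x : ℝ) :
    ‖ζ (x + h) - (2 : ℝ) • ζ x + ζ (x - h)‖ ^ 2 ≤ B * h ^ 4 := by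
  have hdiag : ∀ x, 0 ≤ mixedDeriv c (x, x) := fun x =>
    ge_of_tendsto' (tendsto_inner_secondDiff hc hζ x x) fun h => real_inner_self_nonneg
  have hB0 : 0 ≤ B := (hdiag 0).trans (hB 0)
  -- The mean value theorem below evaluates `mixedDeriv c` at a possibly off-diagonal point, whereas
  -- `hB` bounds the diagonal; Cauchy–Schwarz bridges the two.
  have hCS : ∀ x y, mixedDeriv c (x, y) * mixedDeriv c (x, y) ≤
      mixedDeriv c (x, x) * mixedDeriv c (y, y) := fun x y =>
    le_of_tendsto_of_tendsto'
      ((tendsto_inner_secondDiff hc hζ x y).mul (tendsto_inner_secondDiff hc hζ x y))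
      ((tendsto_inner_secondDiff hc hζ x x).mul (tendsto_inner_secondDiff hc hζ y y))
      fun h => real_inner_mul_inner_self_le _ _
  have hle : ∀ x y, mixedDeriv c (x, y) ≤ B := fun x y => by
    have h1 : mixedDeriv c (x, y) * mixedDeriv c (x, y) ≤ B * B :=
      (hCS x y).trans (mul_le_mul (hB x) (hB y) (hdiag y) hB0)
    nlinarith
  obtain ⟨ξ, η, -, -, e⟩ := exists_secondDiff_secondDiff_eq hc hh x x
  rw [← real_inner_self_eq_norm_sq, inner_secondDiff hζ, e, mul_comm B]
  exact mul_le_mul_of_nonneg_left (hle _ _) (by positivity)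

end SecondDifference

/-! ### Gaussian moments and the random constant -/

section Gaussian

variable {Ω : Type*} [MeasurableSpace Ω] {P : Measure Ω}

/-- The inner product in `L²` of centred random variables is their covariance. -/
lemma inner_toLp_eq_covariance {X Y : Ω → ℝ} (hX : MemLp X 2 P) (hY : MemLp Y 2 P)
    (hX0 : ∫ ω, X ω ∂P = 0) (hY0 : ∫ ω, Y ω ∂P = 0) :
    inner ℝ (hX.toLp X) (hY.toLp Y) = cov[X, Y; P] := by
  rw [L2.inner_def, covariance, hX0, hY0]
  refine integral_congr_ae ?_
  filter_upwards [hX.coeFn_toLp, hY.coeFn_toLp] with ω h1 h2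
  simp [h1, h2, mul_comm]

lemma norm_toLp_sq {X : Ω → ℝ} (hX : MemLp X 2 P) : ‖hX.toLp X‖ ^ 2 = ∫ ω, X ω ^ 2 ∂P := by
  rw [← real_inner_self_eq_norm_sq, L2.inner_def]
  refine integral_congr_ae ?_
  filter_upwards [hX.coeFn_toLp] with ω h1
  simp [h1, sq]

/-- The sixteenth moment of the standard Gaussian distribution. -/
noncomputable def gaussianMoment16 : ℝ := ∫ x, x ^ 16 ∂(gaussianReal 0 1)

lemma gaussianMoment16_nonneg : 0 ≤ gaussianMoment16 := integral_nonneg fun x => by positivity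

lemma integrable_pow16_gaussianReal : Integrable (fun x : ℝ => x ^ 16) (gaussianReal 0 1) := by
  have := (memLp_id_gaussianReal (μ := 0) (v := 1) 16).integrable_norm_pow (p := 16) (by norm_num)
  refine this.congr (ae_of_all _ fun x => ?_)
  simp [Even.pow_abs (show Even 16 by decide)]

/-- A centred Gaussian variable has the law of its standard deviation times a standard one, so its
sixteenth moment scales as the eighth power of the variance. -/
lemma lintegral_pow16_le_of_hasGaussianLaw {X : Ω → ℝ} (hX : HasGaussianLaw X P)
    (hX0 : ∫ ω, X ω ∂P = 0) {v : ℝ} (hv : ∫ ω, X ω ^ 2 ∂P ≤ v) :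
    ∫⁻ ω, ENNReal.ofReal (X ω ^ 16) ∂P ≤ ENNReal.ofReal (gaussianMoment16 * v ^ 8) := by
  have hlaw := hX.map_eq_gaussianReal
  have hvar : Var[X; P] = ∫ ω, X ω ^ 2 ∂P := by
    rw [variance_eq_integral hX.aemeasurable]; simp [hX0]
  have hint0 : 0 ≤ ∫ ω, X ω ^ 2 ∂P := integral_nonneg fun ω => by positivity
  set σ := Real.sqrt (∫ ω, X ω ^ 2 ∂P) with hσ
  have hσ2 : σ ^ 2 = ∫ ω, X ω ^ 2 ∂P := Real.sq_sqrt hint0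
  have hlaw' : P.map X = (gaussianReal 0 1).map (fun x => σ * x) := by
    rw [hlaw, gaussianReal_map_const_mul, hX0, hvar, mul_zero, mul_one]
    congr 1
    ext
    rw [Real.coe_toNNReal _ hint0]
    simp [hσ2]
  have hm : Measurable (fun x : ℝ => ENNReal.ofReal (x ^ 16)) := by fun_prop
  calc ∫⁻ ω, ENNReal.ofReal (X ω ^ 16) ∂P = ∫⁻ x, ENNReal.ofReal (x ^ 16) ∂(P.map X) := by
        rw [lintegral_map' hm.aemeasurable hX.aemeasurable]
    _ = ∫⁻ x, ENNReal.ofReal ((σ * x) ^ 16) ∂(gaussianReal 0 1) := by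
        rw [hlaw', lintegral_map hm (by fun_prop)]
    _ = ENNReal.ofReal (∫ x, (σ * x) ^ 16 ∂(gaussianReal 0 1)) := by
        rw [ofReal_integral_eq_lintegral_ofReal]
        · simp only [mul_pow]
          exact integrable_pow16_gaussianReal.const_mul _
        · exact ae_of_all _ fun x => by positivity
    _ ≤ _ := by
        refine ENNReal.ofReal_le_ofReal ?_
        simp only [mul_pow]
        rw [integral_const_mul, mul_comm]
        refine mul_le_mul_of_nonneg_left ?_ gaussianMoment16_nonneg
        calc σ ^ 16 = (σ ^ 2) ^ 8 := by ring
          _ ≤ v ^ 8 := by rw [hσ2]; gcongr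

lemma hasGaussianLaw_secondDiff {f : ℝ → Ω → ℝ} (hf : IsGaussianProcess f P)
    (h x : ℝ) : HasGaussianLaw (fun ω => secondDiff (fun x => f x ω) h x) P := by
  classical
  let I : Finset ℝ := {x + h, x, x - h}
  let L : (I → ℝ) →L[ℝ] ℝ :=
    ContinuousLinearMap.proj (R := ℝ) (φ := fun _ : I => ℝ) ⟨x + h, by simp [I]⟩ -
      (2 : ℝ) • ContinuousLinearMap.proj (R := ℝ) (φ := fun _ : I => ℝ) ⟨x, by simp [I]⟩ +
      ContinuousLinearMap.proj (R := ℝ) (φ := fun _ : I => ℝ) ⟨x - h, by simp [I]⟩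
  exact (hf.hasGaussianLaw I).map_fun L

lemma summable_one_div_one_add_abs_sq : Summable (fun j : ℤ => 1 / (1 + |(j : ℝ)|) ^ 2) := by
  have h : Summable (fun n : ℕ => 1 / (1 + |((n : ℤ) : ℝ)|) ^ 2) := by
    have := (summable_nat_add_iff 1).2 (Real.summable_one_div_nat_pow.2 (one_lt_two))
    refine this.congr fun n => ?_
    push_cast
    rw [Nat.abs_cast, add_comm]
  exact Summable.of_nat_of_neg h (by simpa using h)

/-- Summability over positions needs a weight in the index `j`, the path estimate one in the point
`j / 2 ^ k`; exchanging them costs `4 ^ k`. -/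
lemma one_add_abs_int_sq_le (k : ℕ) (j : ℤ) :
    (1 + |(j : ℝ)|) ^ 2 ≤ 4 ^ k * (1 + |(j : ℝ) / 2 ^ k|) ^ 2 := by
  have e : (4 : ℝ) ^ k = (2 ^ k) ^ 2 := by rw [← pow_mul, mul_comm, pow_mul]; norm_num
  rw [e, ← mul_pow]
  have h2 : (1 : ℝ) ≤ 2 ^ k := one_le_pow₀ (by norm_num)
  refine pow_le_pow_left₀ (by positivity) ?_ 2
  rw [abs_div, abs_of_pos (show (0 : ℝ) < 2 ^ k by positivity), mul_add, mul_one,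
    mul_div_cancel₀ _ (by positivity)]
  linarith


/-- A smooth centred Gaussian process with bounded variances of the process and of its second
derivative has polynomially controlled dyadic second differences, simultaneously at all scales. -/
theorem exists_dyadic_bound_of_isGaussianProcess [IsProbabilityMeasure P] {f : ℝ → Ω → ℝ} (hf : IsGaussianProcess f P)
    (hf_mean : ∀ x, ∫ ω, f x ω ∂P = 0) (hf_cov : ContDiff ℝ 4 (covFun P f)) {B : ℝ}
    (hB0 : ∀ x, diagMixedDeriv (covFun P f) 0 x ≤ B)
    (hB2 : ∀ x, diagMixedDeriv (covFun P f) 2 x ≤ B) :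
    ∃ W : Ω → ℝ, Integrable W P ∧ (∀ ω, 0 ≤ W ω) ∧ ∀ᵐ ω ∂P,
      (∀ n : ℤ, f n ω ^ 16 ≤ W ω * (1 + |(n : ℝ)|) ^ 2) ∧
      ∀ (k : ℕ) (j : ℤ), (3 ^ k * secondDiff (fun x => f x ω) (1 / 2 ^ k) (j / 2 ^ k)) ^ 16 ≤
        W ω * (1 + |(j : ℝ) / 2 ^ k|) ^ 2 := by
  have hL2 : ∀ x, MemLp (f x) 2 P := fun x => (hf.hasGaussianLaw_eval x).memLp_two
  have hζ : ∀ x y, inner ℝ ((hL2 x).toLp (f x)) ((hL2 y).toLp (f y)) = covFun P f (x, y) :=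
    fun x y => inner_toLp_eq_covariance _ _ (hf_mean x) (hf_mean y)
  have hvar0 : ∀ x, ∫ ω, f x ω ^ 2 ∂P ≤ B := fun x => by
    have h1 := hB0 x
    simp only [diagMixedDeriv, iteratedDeriv_zero] at h1
    rwa [← hζ, real_inner_self_eq_norm_sq, norm_toLp_sq] at h1
  have hB : 0 ≤ B := (integral_nonneg fun ω => by positivity).trans (hvar0 0)
  have hD2 : ∀ h x, MemLp (fun ω => secondDiff (fun x => f x ω) h x) 2 P := fun h x =>
    (hasGaussianLaw_secondDiff hf h x).memLp_two
  have hDmean : ∀ h x, ∫ ω, secondDiff (fun x => f x ω) h x ∂P = 0 := fun h x => by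
    have hi := fun x => (hL2 x).integrable one_le_two
    change ∫ ω, (f (x + h) ω - 2 * f x ω) + f (x - h) ω ∂P = 0
    rw [integral_add (f := fun ω => f (x + h) ω - 2 * f x ω) ((hi _).sub ((hi _).const_mul 2))
      (hi _), integral_sub (hi _) ((hi _).const_mul 2), integral_const_mul, hf_mean, hf_mean, hf_mean]
    simp
  have hvar2 : ∀ h > 0, ∀ x, ∫ ω, secondDiff (fun x => f x ω) h x ^ 2 ∂P ≤ B * h ^ 4 := by
    intro h hh x
    have h1 := norm_secondDiff_le hf_cov hζ
      (fun x => (diagMixedDeriv_two hf_cov x).symm.le.trans (hB2 x)) hh x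
    have e : (hL2 (x + h)).toLp (f (x + h)) - (2 : ℝ) • (hL2 x).toLp (f x) +
        (hL2 (x - h)).toLp (f (x - h)) = (hD2 h x).toLp _ := by
      rw [← MemLp.toLp_const_smul, ← MemLp.toLp_sub, ← MemLp.toLp_add]
      rfl
    rwa [e, norm_toLp_sq] at h1
  set T₀ : ℤ → Ω → ENNReal := fun n ω => ENNReal.ofReal (f n ω ^ 16 / (1 + |(n : ℝ)|) ^ 2) with hT₀
  set T : ℕ → ℤ → Ω → ENNReal := fun k j ω => ENNReal.ofReal
    (4 ^ k * (3 ^ k * secondDiff (fun x => f x ω) (1 / 2 ^ k) (j / 2 ^ k)) ^ 16 /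
      (1 + |(j : ℝ)|) ^ 2) with hT
  have hfm : ∀ x, AEMeasurable (f x) P := fun x => hf.aemeasurable x
  have hT₀m : ∀ n, AEMeasurable (T₀ n) P := fun n =>
    (((hfm n).pow_const 16).div_const _).ennreal_ofReal
  have hTm : ∀ k j, AEMeasurable (T k j) P := fun k j =>
    (((((hasGaussianLaw_secondDiff hf _ _).aemeasurable.const_mul _).pow_const 16).const_mul
      _).div_const _).ennreal_ofReal
  set C := gaussianMoment16 * B ^ 8 with hC
  have hC0 : 0 ≤ C := mul_nonneg gaussianMoment16_nonneg (by positivity)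
  set w : ℤ → ENNReal := fun j => ENNReal.ofReal (1 / (1 + |(j : ℝ)|) ^ 2) with hw
  have hwsum : ∑' j, w j ≠ ⊤ := summable_one_div_one_add_abs_sq.tsum_ofReal_ne_top
  have hT₀i : ∀ n, ∫⁻ ω, T₀ n ω ∂P ≤ ENNReal.ofReal C * w n := fun n => by
    have h1 := lintegral_pow16_le_of_hasGaussianLaw (hf.hasGaussianLaw_eval (n : ℝ)) (hf_mean n)
      (hvar0 n)
    simp only [hT₀, hw, div_eq_mul_one_div (f _ _ ^ 16)]
    simp_rw [ENNReal.ofReal_mul (show (0 : ℝ) ≤ f _ _ ^ 16 by positivity)]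
    rw [lintegral_mul_const' _ _ ENNReal.ofReal_ne_top]
    gcongr
  have hTi : ∀ k j, ∫⁻ ω, T k j ω ∂P ≤
      ENNReal.ofReal ((1 / 2) ^ k) * (ENNReal.ofReal C * w j) := fun k j => by
    have h1 := lintegral_pow16_le_of_hasGaussianLaw
      (hasGaussianLaw_secondDiff hf (1 / 2 ^ k) ((j : ℝ) / 2 ^ k)) (hDmean _ _)
      (hvar2 (1 / 2 ^ k) (by positivity) _)
    have e : ∀ ω, T k j ω = ENNReal.ofReal (4 ^ k * (3 ^ k) ^ 16) *
        ENNReal.ofReal (secondDiff (fun x => f x ω) (1 / 2 ^ k) (j / 2 ^ k) ^ 16) * w j :=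
      fun ω => by
      simp only [hT, hw]
      rw [← ENNReal.ofReal_mul (by positivity), ← ENNReal.ofReal_mul (by positivity)]
      congr 1; ring
    simp_rw [e]
    rw [lintegral_mul_const' _ _ ENNReal.ofReal_ne_top,
      lintegral_const_mul' _ _ ENNReal.ofReal_ne_top, ← mul_assoc]
    refine mul_le_mul' ?_ le_rfl
    refine (mul_le_mul_right h1 _).trans ?_
    rw [← ENNReal.ofReal_mul (by positivity), ← ENNReal.ofReal_mul (by positivity)]
    refine ENNReal.ofReal_le_ofReal ?_
    -- The ratio of the scale sum is `4 * 3 ^ 16 / 2 ^ 32`: weight exchange, normalization by `3 ^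
    -- k`, and moment `O(h ^ 32)`. It is below `1 / 2`.
    have e2 : (4 : ℝ) ^ k * (3 ^ k) ^ 16 * (gaussianMoment16 * (B * (1 / 2 ^ k) ^ 4) ^ 8) =
        (4 * 3 ^ 16 * (1 / 2) ^ 32) ^ k * C := by
      rw [hC, mul_pow (4 * 3 ^ 16 : ℝ), mul_pow (4 : ℝ), pow_right_comm (3 : ℝ),
        pow_right_comm (1 / 2 : ℝ), one_div_pow 2 k]
      ring
    rw [e2]
    gcongr
    norm_num
  set V : Ω → ENNReal := fun ω => ∑' n, T₀ n ω + ∑' k, ∑' j, T k j ω with hV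
  have hVm : AEMeasurable V P := (AEMeasurable.tsum hT₀m).add
    (AEMeasurable.tsum fun k => AEMeasurable.tsum (hTm k))
  have hVi : ∫⁻ ω, V ω ∂P ≠ ⊤ := by
    rw [hV, lintegral_add_left' (AEMeasurable.tsum hT₀m), lintegral_tsum hT₀m,
      lintegral_tsum fun k => AEMeasurable.tsum (hTm k)]
    refine ENNReal.add_ne_top.2 ⟨?_, ?_⟩
    · refine ne_top_of_le_ne_top ?_ (ENNReal.tsum_le_tsum hT₀i)
      rw [ENNReal.tsum_mul_left]
      exact ENNReal.mul_ne_top ENNReal.ofReal_ne_top hwsum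
    · have : ∀ k, ∫⁻ ω, ∑' j, T k j ω ∂P ≤
          ENNReal.ofReal ((1 / 2) ^ k) * (ENNReal.ofReal C * ∑' j, w j) := fun k => by
        rw [lintegral_tsum (hTm k), ← ENNReal.tsum_mul_left, ← ENNReal.tsum_mul_left]
        exact ENNReal.tsum_le_tsum (hTi k)
      refine ne_top_of_le_ne_top ?_ (ENNReal.tsum_le_tsum this)
      rw [ENNReal.tsum_mul_right]
      exact ENNReal.mul_ne_top (summable_geometric_two.tsum_ofReal_ne_top)
        (ENNReal.mul_ne_top ENNReal.ofReal_ne_top hwsum)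
  refine ⟨fun ω => (V ω).toReal, integrable_toReal_of_lintegral_ne_top hVm hVi,
    fun ω => ENNReal.toReal_nonneg, ?_⟩
  filter_upwards [ae_lt_top' hVm hVi] with ω hω
  refine ⟨fun n => ?_, fun k j => ?_⟩
  · have h1 : T₀ n ω ≤ V ω := (ENNReal.le_tsum n).trans le_self_add
    have h2 := (ENNReal.ofReal_le_iff_le_toReal hω.ne).1 h1
    rwa [div_le_iff₀ (by positivity)] at h2
  · have h1 : T k j ω ≤ V ω :=
      ((ENNReal.le_tsum (f := fun j => T k j ω) j).trans
        (ENNReal.le_tsum (f := fun k => ∑' j, T k j ω) k)).trans le_add_self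
    have h2 := (ENNReal.ofReal_le_iff_le_toReal hω.ne).1 h1
    rw [div_le_iff₀ (by positivity)] at h2
    have h3 := h2.trans (mul_le_mul_of_nonneg_left (one_add_abs_int_sq_le k j)
      ENNReal.toReal_nonneg)
    rw [← mul_assoc, mul_comm _ ((4 : ℝ) ^ k), mul_assoc] at h3
    exact le_of_mul_le_mul_left h3 (by positivity)

end Gaussian

/-! ### Deterministic estimates of the linearization error -/

/-- Quantitative Taylor expansion of a continuous function from polynomial control of its dyadic
second differences. -/
lemma taylor_of_dyadic_bound {F : ℝ → ℝ} (hF : Continuous F) {W : ℝ} (hW : 0 ≤ W)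
    (h0 : ∀ n : ℤ, F n ^ 16 ≤ W * (1 + |(n : ℝ)|) ^ 2)
    (h1 : ∀ (k : ℕ) (j : ℤ), (3 ^ k * secondDiff F (1 / 2 ^ k) (j / 2 ^ k)) ^ 16 ≤
      W * (1 + |(j : ℝ) / 2 ^ k|) ^ 2) {x y K : ℝ} (hK : 0 ≤ K)
    (hKW : K ^ 8 = W + (3 + |x| + |y|) ^ 2) :
    |F x| ≤ 4 * K ∧ |F y| ≤ 4 * K ∧ |deriv F x| ≤ 3 * K ∧ HasDerivAt F (deriv F x) x ∧
      (F y - F x - deriv F x * (y - x)) ^ 2 ≤ 128 * K ^ 2 * |y - x| ^ 3 := by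
  have key : ∀ a b : ℝ, |b| ≤ |x| + |y| + 2 → a ^ 16 ≤ W * (1 + |b|) ^ 2 → |a| ≤ K := by
    intro a b hb hab
    have e1 : (1 + |b|) ^ 2 ≤ (3 + |x| + |y|) ^ 2 :=
      pow_le_pow_left₀ (by positivity) (by linarith) 2
    -- The product of `W` and the squared spatial weight is at most the square of their sum. This is
    -- why sixteenth powers are controlled: they leave `K ^ 8` integrable with no independence of
    -- `W` and the points.
    have e2 : |a| ^ 16 ≤ K ^ 16 := by
      rw [Even.pow_abs (by decide)]
      calc a ^ 16 ≤ W * (1 + |b|) ^ 2 := hab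
        _ ≤ W * (3 + |x| + |y|) ^ 2 := by gcongr
        _ ≤ (W + (3 + |x| + |y|) ^ 2) ^ 2 := by
          nlinarith [sq_nonneg (3 + |x| + |y|), mul_nonneg hW (sq_nonneg (3 + |x| + |y|))]
        _ = K ^ 16 := by rw [← hKW]; ring
    exact le_of_pow_le_pow_left₀ (by norm_num) hK e2
  have hs : DyadicSmooth F K (|x| + |y| + 2) := fun k j hj => by
    have := key _ _ hj (h1 k j)
    rw [abs_mul, abs_of_pos (show (0 : ℝ) < 3 ^ k by positivity)] at this
    rwa [le_div_iff₀ (by positivity), mul_comm]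
  have hn : ∀ n : ℤ, |(n : ℝ)| ≤ |x| + |y| + 2 → |F n| ≤ K := fun n hn => key _ _ hn (h0 n)
  have hx : |x| ≤ |x| + |y| := by linarith [abs_nonneg y]
  have hy : |y| ≤ |x| + |y| := by linarith [abs_nonneg x]
  obtain ⟨a1, a2, a3, a4⟩ := hs.taylor hF hn hx
  exact ⟨a1, (hs.taylor hF hn hy).1, a2, a3, a4 y hy⟩

/-- Two arithmetic–geometric mean inequalities. The exponents are the available moments: `K ^ 8` is
integrable and gets a small factor, `x ^ 4` may carry a large one. -/
lemma sq_mul_cube_le {δ : ℝ} (hδ : 0 < δ) (K x : ℝ) :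
    K ^ 2 * x ^ 3 ≤ δ * K ^ 8 + (1 / (16 * δ) + 1 / 2) * x ^ 4 := by
  have h1 : K ^ 2 * x ^ 3 ≤ (K ^ 4 * x ^ 2 + x ^ 4) / 2 := by nlinarith [sq_nonneg (K ^ 2 * x - x ^ 2)]
  have h2 : K ^ 4 * x ^ 2 ≤ 2 * δ * K ^ 8 + 1 / (8 * δ) * x ^ 4 := by
    have : 0 ≤ 2 * δ * (K ^ 4 - 1 / (4 * δ) * x ^ 2) ^ 2 := by positivity
    have e : 2 * δ * (K ^ 4 - 1 / (4 * δ) * x ^ 2) ^ 2 =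
        2 * δ * K ^ 8 + 1 / (8 * δ) * x ^ 4 - K ^ 4 * x ^ 2 := by field_simp; ring
    linarith
  have e : 1 / (8 * δ) * x ^ 4 / 2 = 1 / (16 * δ) * x ^ 4 := by field_simp; ring
  linarith

lemma sq_mul_sq_le {δ : ℝ} (hδ : 0 < δ) (a b : ℝ) :
    a ^ 2 * b ^ 2 ≤ δ * a ^ 4 + 1 / (4 * δ) * b ^ 4 := by
  have : 0 ≤ δ * (a ^ 2 - 1 / (2 * δ) * b ^ 2) ^ 2 := by positivity
  have e : δ * (a ^ 2 - 1 / (2 * δ) * b ^ 2) ^ 2 = δ * a ^ 4 + 1 / (4 * δ) * b ^ 4 - a ^ 2 * b ^ 2 := by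
    field_simp; ring
  linarith

/-- Young type estimate of the squared linearization error: `K` controls the outer process, `D` the
gradient and `r` the remainder of the inner field at distance `u ^ 3`. -/
lemma exists_sq_error_le {ε : ℝ} (hε : 0 < ε) : ∃ C, 0 ≤ C ∧ ∀ u K D r e : ℝ, 0 < u → u ≤ 1 →
    0 ≤ K → 0 ≤ D → 0 ≤ r →
    e ^ 2 ≤ 1024 * K ^ 2 * (u ^ 9 * D ^ 3 + r ^ 3) + 18 * K ^ 2 * r ^ 2 →
    e ^ 2 ≤ 128 * K ^ 2 + 18 * K ^ 2 * (u ^ 6 * D ^ 2) →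
    e ^ 2 / u ^ 6 ≤ ε * (K ^ 8 + D ^ 4 + 1) + C * (u ^ 4 * D ^ 4 + r ^ 2 / u ^ 10) := by
  set δ := ε / 3000 with hδ
  have hδ0 : 0 < δ := by positivity
  have hε' : ε = 3000 * δ := by rw [hδ]; ring
  set c := 1 / (16 * δ) + 1 / 2 with hc
  have hc0 : 0 < c := by positivity
  set c₁ := 1 / (4 * δ) with hc₁
  have hc₁0 : 0 < c₁ := by positivity
  set c₂ := 1 / (4 * (δ / c₁)) with hc₂
  have hc₂0 : 0 < c₂ := by positivity
  refine ⟨2048 * c + 18 * c₁ + 18 * (c₁ * c₂), by positivity,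
    fun u K D r e hu hu1 hK hD hr h1 h2 => ?_⟩
  have hK8 : 0 ≤ K ^ 8 := by positivity
  have hD4 : 0 ≤ D ^ 4 := by positivity
  have hru : 0 ≤ r ^ 2 / u ^ 10 := by positivity
  have huD : 0 ≤ u ^ 4 * D ^ 4 := by positivity
  -- Truncation of the remainder. For `r ≤ u` one has `(r / u ^ 3) ^ 4 ≤ r ^ 2 / u ^ 10`, so two
  -- moments of `r` suffice. For `r > u` the crude bound `h2` applies, and `1 < r ^ 2 / u ^ 2` pays
  -- for its negative powers of `u`.
  rcases le_or_gt r u with hru1 | hru1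
  · set x := r / u ^ 3 with hx
    have hx0 : 0 ≤ x := by positivity
    have hrx : r = x * u ^ 3 := by rw [hx]; field_simp
    have hx4 : x ^ 4 ≤ r ^ 2 / u ^ 10 := by
      rw [hx, div_pow, div_le_div_iff₀ (by positivity) (by positivity)]
      calc r ^ 4 * u ^ 10 = r ^ 2 * u ^ 10 * r ^ 2 := by ring
        _ ≤ r ^ 2 * u ^ 10 * u ^ 2 := by gcongr
        _ = _ := by ring
    have a1 := sq_mul_cube_le hδ0 K (u * D)
    have a2 := sq_mul_cube_le hδ0 K x
    have a3 := sq_mul_sq_le hδ0 K x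
    rw [← hc] at a1 a2
    rw [← hc₁] at a3
    have a4 : K ^ 4 ≤ 1 + K ^ 8 := by nlinarith [sq_nonneg (K ^ 4 - 1)]
    have a5 : K ^ 2 * (x ^ 3 * u ^ 3) ≤ K ^ 2 * x ^ 3 := by
      have : u ^ 3 ≤ 1 := pow_le_one₀ hu.le hu1
      have : x ^ 3 * u ^ 3 ≤ x ^ 3 := mul_le_of_le_one_right (by positivity) this
      gcongr
    have a6 : e ^ 2 / u ^ 6 ≤ 1024 * (K ^ 2 * (u * D) ^ 3) + 1024 * (K ^ 2 * (x ^ 3 * u ^ 3)) +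
        18 * (K ^ 2 * x ^ 2) := by
      rw [div_le_iff₀ (by positivity)]
      refine h1.trans (le_of_eq ?_)
      rw [hrx]; ring
    have a7 : δ * K ^ 4 ≤ δ * (1 + K ^ 8) := by gcongr
    have a8 : c * x ^ 4 ≤ c * (r ^ 2 / u ^ 10) := by gcongr
    have a9 : c₁ * x ^ 4 ≤ c₁ * (r ^ 2 / u ^ 10) := by gcongr
    have b1 : 0 ≤ c * (u ^ 4 * D ^ 4) := by positivity
    have b2 : 0 ≤ c₁ * (u ^ 4 * D ^ 4) := by positivity
    have b3 : 0 ≤ c₁ * c₂ * (u ^ 4 * D ^ 4) := by positivity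
    have b4 : 0 ≤ c₁ * c₂ * (r ^ 2 / u ^ 10) := by positivity
    have b5 : 0 ≤ c * (r ^ 2 / u ^ 10) := by positivity
    have b6 : 0 ≤ δ * K ^ 8 := by positivity
    have b7 : 0 ≤ δ * D ^ 4 := by positivity
    rw [mul_pow u D 4] at a1
    rw [hε']
    linarith
  · have hone : 1 ≤ r ^ 2 / u ^ 2 := by
      rw [one_le_div (by positivity)]; gcongr
    have a0 : (1 / u ^ 2) ^ 4 ≤ r ^ 2 / u ^ 10 := by
      calc (1 / u ^ 2) ^ 4 = 1 / u ^ 8 * 1 := by rw [div_pow]; ring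
        _ ≤ 1 / u ^ 8 * (r ^ 2 / u ^ 2) := by gcongr
        _ = _ := by field_simp
    have a0' : 1 ≤ r ^ 2 / u ^ 10 := by
      refine le_trans ?_ a0
      rw [div_pow, ← pow_mul, one_pow]
      exact (one_le_div (by positivity)).2 (pow_le_one₀ hu.le hu1)
    have a1 := sq_mul_cube_le hδ0 K (1 / u ^ 2)
    rw [← hc] at a1
    have a2 := sq_mul_sq_le hδ0 D K
    rw [← hc₁] at a2
    have a3 := sq_mul_sq_le (show 0 < δ / c₁ by positivity) (K ^ 2) 1
    rw [← hc₂] at a3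
    have a3' : c₁ * K ^ 4 ≤ δ * K ^ 8 + c₁ * c₂ := by
      have := mul_le_mul_of_nonneg_left a3 hc₁0.le
      have e1 : c₁ * (δ / c₁ * (K ^ 2) ^ 4 + c₂ * 1 ^ 4) = δ * K ^ 8 + c₁ * c₂ := by
        field_simp
      have e2 : c₁ * ((K ^ 2) ^ 2 * 1 ^ 2) = c₁ * K ^ 4 := by ring
      linarith
    have a6 : e ^ 2 / u ^ 6 ≤ 128 * (K ^ 2 * (1 / u ^ 2) ^ 3) + 18 * (D ^ 2 * K ^ 2) := by
      rw [div_le_iff₀ (by positivity)]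
      refine h2.trans (le_of_eq ?_)
      field_simp
    have a8 : c * (1 / u ^ 2) ^ 4 ≤ c * (r ^ 2 / u ^ 10) := by gcongr
    have a9 : c₁ * c₂ * 1 ≤ c₁ * c₂ * (r ^ 2 / u ^ 10) := by gcongr
    have b1 : 0 ≤ c * (u ^ 4 * D ^ 4) := by positivity
    have b2 : 0 ≤ c₁ * (u ^ 4 * D ^ 4) := by positivity
    have b3 : 0 ≤ c₁ * c₂ * (u ^ 4 * D ^ 4) := by positivity
    have b4 : 0 ≤ c₁ * (r ^ 2 / u ^ 10) := by positivity
    have b5 : 0 ≤ c * (r ^ 2 / u ^ 10) := by positivity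
    have b6 : 0 ≤ δ * K ^ 8 := by positivity
    have b7 : 0 ≤ δ * D ^ 4 := by positivity
    rw [hε']
    linarith

/-- The linearization error of a composition, in the form needed for `exists_sq_error_le`. -/
lemma sq_linearization_error_le {fx fy m v Δ K D u : ℝ} (hu : 0 < u)
    (hD : 0 ≤ D) (hv : |v| ≤ u ^ 3 * D) (hm : |m| ≤ 3 * K) (hfx : |fx| ≤ 4 * K) (hfy : |fy| ≤ 4 * K)
    (hT : (fy - fx - m * Δ) ^ 2 ≤ 128 * K ^ 2 * |Δ| ^ 3) :
    (fy - fx - m * v) ^ 2 ≤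
        1024 * K ^ 2 * (u ^ 9 * D ^ 3 + |Δ - v| ^ 3) + 18 * K ^ 2 * |Δ - v| ^ 2 ∧
      (fy - fx - m * v) ^ 2 ≤ 128 * K ^ 2 + 18 * K ^ 2 * (u ^ 6 * D ^ 2) := by
  have hm2 : m ^ 2 ≤ 9 * K ^ 2 := by
    rw [← sq_abs]; calc _ ≤ (3 * K) ^ 2 := by gcongr
      _ = _ := by ring
  constructor
  · have e : fy - fx - m * v = (fy - fx - m * Δ) + m * (Δ - v) := by ring
    have h1 : (fy - fx - m * v) ^ 2 ≤ 2 * (fy - fx - m * Δ) ^ 2 + 2 * (m * (Δ - v)) ^ 2 := by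
      rw [e]; nlinarith [sq_nonneg ((fy - fx - m * Δ) - m * (Δ - v))]
    have h2 : (m * (Δ - v)) ^ 2 ≤ 9 * K ^ 2 * |Δ - v| ^ 2 := by
      rw [mul_pow, sq_abs]; gcongr
    have h3 : |Δ| ≤ u ^ 3 * D + |Δ - v| := by
      have : |Δ| ≤ |v| + |Δ - v| := by
        calc |Δ| = |v + (Δ - v)| := by congr 1; ring
          _ ≤ _ := abs_add_le _ _
      linarith
    have h4 : |Δ| ^ 3 ≤ 4 * (u ^ 9 * D ^ 3 + |Δ - v| ^ 3) := by
      have hr := abs_nonneg (Δ - v)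
      have hq : 0 ≤ u ^ 3 * D := by positivity
      calc |Δ| ^ 3 ≤ (u ^ 3 * D + |Δ - v|) ^ 3 := by gcongr
        _ ≤ 4 * ((u ^ 3 * D) ^ 3 + |Δ - v| ^ 3) := by
          nlinarith [mul_nonneg (add_nonneg hq hr) (sq_nonneg (u ^ 3 * D - |Δ - v|))]
        _ = _ := by ring
    have h5 : 128 * K ^ 2 * |Δ| ^ 3 ≤ 128 * K ^ 2 * (4 * (u ^ 9 * D ^ 3 + |Δ - v| ^ 3)) := by gcongr
    linarith
  · have h1 : (fy - fx - m * v) ^ 2 ≤ 2 * (fy - fx) ^ 2 + 2 * (m * v) ^ 2 := by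
      nlinarith [sq_nonneg ((fy - fx) + m * v)]
    have h2 : (fy - fx) ^ 2 ≤ 64 * K ^ 2 := by
      rw [← sq_abs]
      calc _ ≤ (8 * K) ^ 2 := by gcongr; exact (abs_sub _ _).trans (by linarith)
        _ = _ := by ring
    have h3 : (m * v) ^ 2 ≤ 9 * K ^ 2 * (u ^ 6 * D ^ 2) := by
      rw [mul_pow, ← sq_abs v]
      calc m ^ 2 * |v| ^ 2 ≤ 9 * K ^ 2 * (u ^ 3 * D) ^ 2 := by gcongr
        _ = _ := by ring
    linarith

/-! ### Measurability, `L²` bounds and the gradient of the inner field -/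

section Composition

variable {Ω : Type*} [MeasurableSpace Ω] {P : Measure Ω}

/-- Evaluation of a process with continuous paths at a random point is measurable. -/
lemma aemeasurable_eval_of_continuous {f : ℝ → Ω → ℝ} (hf : ∀ x, AEMeasurable (f x) P)
    (hc : ∀ᵐ ω ∂P, Continuous (fun x => f x ω)) {Y : Ω → ℝ} (hY : AEMeasurable Y P) :
    AEMeasurable (fun ω => f (Y ω) ω) P := by
  -- The discretized point takes countably many values, which gives measurability; path continuity
  -- passes to the limit.
  have hstep : ∀ k : ℕ, AEMeasurable (fun ω => f ((dyadicIndex k (Y ω) : ℝ) / 2 ^ k) ω) P := by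
    intro k
    let G : ℤ × Ω → ℝ := fun p => (hf ((p.1 : ℝ) / 2 ^ k)).mk _ p.2
    have hG : Measurable G :=
      measurable_from_prod_countable_right fun j => (hf ((j : ℝ) / 2 ^ k)).measurable_mk
    have hN : AEMeasurable (fun ω => (dyadicIndex k (Y ω), ω)) P :=
      (Int.measurable_floor.comp_aemeasurable (hY.mul_const _)).prodMk aemeasurable_id
    refine (hG.comp_aemeasurable hN).congr ?_
    filter_upwards [ae_all_iff.2 fun j : ℤ => (hf ((j : ℝ) / 2 ^ k)).ae_eq_mk] with ω hω
    exact (hω _).symm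
  refine aemeasurable_of_tendsto_metrizable_ae atTop hstep ?_
  filter_upwards [hc] with ω hω
  exact (hω.tendsto (Y ω)).comp (tendsto_dyadicIndex_div (Y ω))

lemma aemeasurable_deriv_eval {f : ℝ → Ω → ℝ} (hf : ∀ x, AEMeasurable (f x) P)
    (hc : ∀ᵐ ω ∂P, Continuous (fun x => f x ω)) {Y : Ω → ℝ} (hY : AEMeasurable Y P)
    (hd : ∀ᵐ ω ∂P, DifferentiableAt ℝ (fun x => f x ω) (Y ω)) :
    AEMeasurable (fun ω => deriv (fun x => f x ω) (Y ω)) P := by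
  have hu : Tendsto (fun n : ℕ => (1 : ℝ) / (n + 1)) atTop (𝓝[≠] 0) :=
    tendsto_nhdsWithin_iff.2 ⟨tendsto_one_div_add_atTop_nhds_zero_nat,
      Eventually.of_forall fun n => by
        have : (0 : ℝ) < 1 / (n + 1) := by positivity
        exact this.ne'⟩
  refine aemeasurable_of_tendsto_metrizable_ae atTop
    (f := fun (n : ℕ) ω => ((1 : ℝ) / (n + 1))⁻¹ * (f (Y ω + 1 / (n + 1)) ω - f (Y ω) ω))
    (fun n => ((aemeasurable_eval_of_continuous hf hc (hY.add_const _)).sub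
      (aemeasurable_eval_of_continuous hf hc hY)).const_mul _) ?_
  filter_upwards [hd] with ω hω
  exact (hasDerivAt_iff_tendsto_slope_zero.1 hω.hasDerivAt).comp hu

lemma eLpNorm_two_le_of_sq_le {g G : Ω → ℝ} (hG : Integrable G P) (hgG : ∀ᵐ ω ∂P, g ω ^ 2 ≤ G ω)
    {b : ℝ} (hb : 0 ≤ b) (hGb : ∫ ω, G ω ∂P ≤ b ^ 2) : eLpNorm g 2 P ≤ ENNReal.ofReal b := by
  have h1 : ∫⁻ ω, ‖g ω‖ₑ ^ (2 : ℝ) ∂P ≤ ENNReal.ofReal (b ^ 2) := by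
    calc _ ≤ ∫⁻ ω, ENNReal.ofReal (G ω) ∂P := by
          refine lintegral_mono_ae ?_
          filter_upwards [hgG] with ω hω
          rw [Real.enorm_eq_ofReal_abs, ENNReal.ofReal_rpow_of_nonneg (abs_nonneg _) (by norm_num)]
          refine ENNReal.ofReal_le_ofReal ?_
          rw [Real.rpow_two, sq_abs]; exact hω
      _ = ENNReal.ofReal (∫ ω, G ω ∂P) := by
          rw [ofReal_integral_eq_lintegral_ofReal hG]
          filter_upwards [hgG] with ω hω using (sq_nonneg _).trans hω
      _ ≤ _ := ENNReal.ofReal_le_ofReal hGb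
  rw [eLpNorm_eq_lintegral_rpow_enorm_toReal two_ne_zero ENNReal.ofNat_ne_top]
  simp only [ENNReal.toReal_ofNat]
  calc _ ≤ (ENNReal.ofReal (b ^ 2)) ^ (1 / 2 : ℝ) := by gcongr
    _ = ENNReal.ofReal b := by
      rw [ENNReal.ofReal_rpow_of_nonneg (by positivity) (by norm_num), ← Real.sqrt_eq_rpow,
        Real.sqrt_sq hb]

lemma memLp_two_of_sq_le {g G : Ω → ℝ} (hg : AEMeasurable g P) (hG : Integrable G P)
    (hgG : ∀ᵐ ω ∂P, g ω ^ 2 ≤ G ω) : MemLp g 2 P := by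
  refine ⟨hg.aestronglyMeasurable, (eLpNorm_two_le_of_sq_le (b := Real.sqrt (∫ ω, G ω ∂P)) hG hgG
    (Real.sqrt_nonneg _) ?_).trans_lt ENNReal.ofReal_lt_top⟩
  rw [Real.sq_sqrt]
  refine integral_nonneg_of_ae ?_
  filter_upwards [hgG] with ω hω using (sq_nonneg _).trans hω

/-- A centred square integrable field with a four times continuously differentiable covariance
function has a mean square gradient, with a remainder of quadratic order. -/
theorem exists_gradient_of_contDiff_covFun {S : Set Plane} {Z : Plane → Ω → ℝ}
    (hZ_L2 : ∀ s ∈ S, MemLp (Z s) 2 P) (hZ_mean : ∀ s ∈ S, ∫ ω, Z s ω ∂P = 0)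
    (hZ_cov : IsContDiffUpTo 4 (S ×ˢ S) (covFun P Z)) {s : Plane} (hs : s ∈ S)
    (hS : UniqueDiffWithinAt ℝ S s) :
    ∃ (D : Fin 2 → Ω → ℝ) (A : ℝ), 0 ≤ A ∧ (∀ i, MemLp (D i) 2 P) ∧ ∀ t ∈ S, ‖t - s‖ ≤ 1 →
      ∫ ω, (Z t ω - Z s ω - ∑ i, (t i - s i) * D i ω) ^ 2 ∂P ≤ (A * ‖t - s‖ ^ 2) ^ 2 := by
  classical
  obtain ⟨K, hK, hKZ⟩ := hZ_cov
  -- The value `0` off `S` is arbitrary: the kernel is compared with inner products on `S` only.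
  let ζ : Plane → Lp ℝ 2 P := fun x => if h : x ∈ S then (hZ_L2 x h).toLp (Z x) else 0
  have hζ : ∀ x (hx : x ∈ S), ζ x = (hZ_L2 x hx).toLp (Z x) := fun x hx => dif_pos hx
  obtain ⟨η, A, hA, h⟩ := exists_gradient_of_contDiff_kernel (ζ := ζ) (K := K)
    (by exact_mod_cast hK) (fun x hx y hy => by
      rw [hζ x hx, hζ y hy, inner_toLp_eq_covariance _ _ (hZ_mean x hx) (hZ_mean y hy)]
      exact hKZ (Set.mk_mem_prod hx hy)) hs hS
  have hη : ∀ i, MemLp (η i) 2 P := fun i => Lp.memLp (η i)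
  refine ⟨fun i => η i, A, hA, hη, fun t ht hts => ?_⟩
  have h1 := h t ht hts
  have hm : MemLp (fun ω => Z t ω - Z s ω - ∑ i, (t i - s i) * η i ω) 2 P :=
    ((hZ_L2 t ht).sub (hZ_L2 s hs)).sub (memLp_finsetSum _ fun i _ => (hη i).const_mul _)
  have e : ζ t - ζ s - ∑ i, (t i - s i) • η i = hm.toLp _ := by
    refine Lp.ext ?_
    rw [hζ t ht, hζ s hs, Fin.sum_univ_two]
    filter_upwards [hm.coeFn_toLp, (hZ_L2 t ht).coeFn_toLp, (hZ_L2 s hs).coeFn_toLp,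
      Lp.coeFn_sub ((hZ_L2 t ht).toLp (Z t) - (hZ_L2 s hs).toLp (Z s))
        ((t 0 - s 0) • η 0 + (t 1 - s 1) • η 1),
      Lp.coeFn_sub ((hZ_L2 t ht).toLp (Z t)) ((hZ_L2 s hs).toLp (Z s)),
      Lp.coeFn_add ((t 0 - s 0) • η 0) ((t 1 - s 1) • η 1),
      Lp.coeFn_smul (t 0 - s 0) (η 0), Lp.coeFn_smul (t 1 - s 1) (η 1)]
      with ω a1 a2 a3 a4 a5 a6 a7 a8
    rw [a4, Pi.sub_apply, a5, Pi.sub_apply, a6, Pi.add_apply, a7, a8, a2, a3, a1, Fin.sum_univ_two]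
    rfl
  rw [← norm_toLp_sq hm, ← e]
  gcongr

/-- The second moments of a centred field with continuous covariance are bounded on compact
sets. -/
lemma exists_integral_sq_le {S : Set Plane} (hS : IsCompact S) {Z : Plane → Ω → ℝ}
    (hZ_L2 : ∀ s ∈ S, MemLp (Z s) 2 P) (hZ_mean : ∀ s ∈ S, ∫ ω, Z s ω ∂P = 0)
    (hZ_cov : IsContDiffUpTo 4 (S ×ˢ S) (covFun P Z)) :
    ∃ V, 0 ≤ V ∧ ∀ t ∈ S, ∫ ω, Z t ω ^ 2 ∂P ≤ V := by
  obtain ⟨K, hK, hKZ⟩ := hZ_cov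
  obtain ⟨V, hV⟩ := hS.exists_bound_of_continuousOn (f := fun t : Plane => K (t, t))
    (hK.continuous.comp (continuous_id.prodMk continuous_id)).continuousOn
  refine ⟨max V 0, le_max_right _ _, fun t ht => ?_⟩
  rw [← norm_toLp_sq (hZ_L2 t ht), ← real_inner_self_eq_norm_sq,
    inner_toLp_eq_covariance _ _ (hZ_mean t ht) (hZ_mean t ht)]
  refine le_trans (le_of_eq (hKZ (Set.mk_mem_prod ht ht))) ?_
  exact (le_abs_self _).trans ((hV t ht).trans (le_max_left _ _))

/-- The fourth moment hypothesis of the theorem concerns mean square gradients; this qualifies the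
constructed `D` as one. -/
lemma IsMeanSquareGradient.of_quadratic_bound {S : Set Plane} {Z : Plane → Ω → ℝ}
    (hZ_L2 : ∀ s ∈ S, MemLp (Z s) 2 P) {s : Plane} (hs : s ∈ S) {D : Fin 2 → Ω → ℝ}
    (hD : ∀ i, MemLp (D i) 2 P) {A : ℝ} (hA : 0 ≤ A)
    (h : ∀ t ∈ S, ‖t - s‖ ≤ 1 →
      ∫ ω, (Z t ω - Z s ω - ∑ i, (t i - s i) * D i ω) ^ 2 ∂P ≤ (A * ‖t - s‖ ^ 2) ^ 2) :
    IsMeanSquareGradient P S Z s D := by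
  refine ⟨hD, ?_⟩
  have hlim : Tendsto (fun t : Plane => ENNReal.ofReal (A * ‖t - s‖)) (𝓝[S \ {s}] s) (𝓝 0) := by
    have hc : Continuous (fun t : Plane => ENNReal.ofReal (A * ‖t - s‖)) :=
      ENNReal.continuous_ofReal.comp (by fun_prop)
    simpa using (hc.tendsto s).mono_left nhdsWithin_le_nhds
  refine tendsto_of_tendsto_of_tendsto_of_le_of_le' tendsto_const_nhds hlim
    (Eventually.of_forall fun _ => zero_le) ?_
  filter_upwards [self_mem_nhdsWithin, nhdsWithin_le_nhds (Metric.closedBall_mem_nhds s one_pos)]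
    with t ht ht1
  rw [mem_closedBall_iff_norm] at ht1
  have hpos : 0 < ‖t - s‖ := norm_pos_iff.2 (sub_ne_zero.2 ht.2)
  have hm : MemLp (fun ω => Z t ω - Z s ω - ∑ i, (t i - s i) * D i ω) 2 P :=
    ((hZ_L2 t ht.1).sub (hZ_L2 s hs)).sub (memLp_finsetSum _ fun i _ => (hD i).const_mul _)
  refine eLpNorm_two_le_of_sq_le (hm.integrable_sq.div_const (‖t - s‖ ^ 2))
    (ae_of_all _ fun ω => le_of_eq (div_pow _ _ _)) (by positivity) ?_
  rw [integral_div, div_le_iff₀ (by positivity)]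
  exact (h t ht.1 ht1).trans (le_of_eq (by ring))

end Composition

/-! ### The composition theorem -/

lemma memLp_three_add_abs {Ω : Type*} [MeasurableSpace Ω] {P : Measure Ω} [IsProbabilityMeasure P]
    {X Y : Ω → ℝ} (hX : MemLp X 2 P) (hY : MemLp Y 2 P) :
    MemLp (fun ω => 3 + |X ω| + |Y ω|) 2 P := by
  have h3 : MemLp (fun _ : Ω => (3 : ℝ)) 2 P := memLp_const 3
  have h1 : MemLp (fun ω => |X ω|) 2 P := hX.norm
  have h2 : MemLp (fun ω => |Y ω|) 2 P := hY.norm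
  exact (h3.add h1).add h2

lemma integral_three_add_abs_sq_le {Ω : Type*} [MeasurableSpace Ω] {P : Measure Ω}
    [IsProbabilityMeasure P] {X Y : Ω → ℝ} (hX : MemLp X 2 P) (hY : MemLp Y 2 P) :
    ∫ ω, (3 + |X ω| + |Y ω|) ^ 2 ∂P ≤ 3 * (9 + ∫ ω, X ω ^ 2 ∂P + ∫ ω, Y ω ^ 2 ∂P) := by
  have i1 := hX.integrable_sq
  have i2 := hY.integrable_sq
  have i0 : Integrable (fun _ : Ω => (9 : ℝ)) P := integrable_const 9
  calc ∫ ω, (3 + |X ω| + |Y ω|) ^ 2 ∂P ≤ ∫ ω, 3 * (9 + X ω ^ 2 + Y ω ^ 2) ∂P := by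
        refine integral_mono (memLp_three_add_abs hX hY).integrable_sq
          (((i0.add i1).add i2).const_mul 3) fun ω => ?_
        simp only
        nlinarith [sq_nonneg (3 - |X ω|), sq_nonneg (3 - |Y ω|),
          sq_nonneg (|X ω| - |Y ω|), sq_abs (X ω), sq_abs (Y ω)]
    _ = 3 * (9 + ∫ ω, X ω ^ 2 ∂P + ∫ ω, Y ω ^ 2 ∂P) := by
        rw [integral_const_mul, integral_add (f := fun ω => 9 + X ω ^ 2) (i0.add i1) i2,
          integral_add i0 i1]
        simp

theorem lemma5 {Ω : Type*} [MeasurableSpace Ω] (P : Measure Ω) [IsProbabilityMeasure P]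
    (f : ℝ → Ω → ℝ)
    (hf_gauss : IsGaussianProcess f P)
    (hf_mean : ∀ x, ∫ ω, f x ω ∂P = 0)
    (hf_path : ∀ᵐ ω ∂P, Continuous (fun x => f x ω))
    (hf_cov : ContDiff ℝ 4 (covFun P f))
    (hf_bdd : ∃ B : ℝ, ∀ k ≤ 2, ∀ x, diagMixedDeriv (covFun P f) k x ≤ B)
    (S : Set Plane) (hS : IsCompact S) (hS_diff : UniqueDiffOn ℝ S)
    (Z : Plane → Ω → ℝ)
    (hZ_L2 : ∀ s ∈ S, MemLp (Z s) 2 P)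
    (hZ_mean : ∀ s ∈ S, ∫ ω, Z s ω ∂P = 0)
    (hZ_cov : IsContDiffUpTo 4 (S ×ˢ S) (covFun P Z))
    (hZ_four : ∀ s ∈ S, ∀ D : Fin 2 → Ω → ℝ, IsMeanSquareGradient P S Z s D →
      ∀ i, MemLp (D i) 4 P) :
    MeanSquareDifferentiableOn P S (fun s ω => f (Z s ω) ω) := by
  obtain ⟨B, hB⟩ := hf_bdd
  obtain ⟨W, hWi, hW0, hWae⟩ := exists_dyadic_bound_of_isGaussianProcess hf_gauss hf_mean hf_cov
    (fun x => hB 0 (by norm_num) x) (fun x => hB 2 le_rfl x)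
  obtain ⟨V, hV0, hV⟩ := exists_integral_sq_le hS hZ_L2 hZ_mean hZ_cov
  have hfm : ∀ x, AEMeasurable (f x) P := fun x => hf_gauss.aemeasurable x
  intro s hs
  have hZm : ∀ t ∈ S, AEMeasurable (Z t) P := fun t ht => (hZ_L2 t ht).aestronglyMeasurable.aemeasurable
  obtain ⟨D, A, hA, hD2, hDA⟩ := exists_gradient_of_contDiff_covFun hZ_L2 hZ_mean hZ_cov hs
    (hS_diff s hs)
  have hD4 := hZ_four s hs D (.of_quadratic_bound hZ_L2 hs hD2 hA hDA)
  set Q : Plane → Ω → ℝ := fun t ω => W ω + (3 + |Z s ω| + |Z t ω|) ^ 2 with hQ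
  have hQ0 : ∀ t ω, 0 ≤ Q t ω := fun t ω => add_nonneg (hW0 ω) (sq_nonneg _)
  set K : Plane → Ω → ℝ := fun t ω => Q t ω ^ (1 / 8 : ℝ) with hK
  have hK0 : ∀ t ω, 0 ≤ K t ω := fun t ω => Real.rpow_nonneg (hQ0 t ω) _
  have hK8 : ∀ t ω, K t ω ^ 8 = Q t ω := fun t ω => by
    rw [hK, ← Real.rpow_natCast, ← Real.rpow_mul (hQ0 t ω)]; norm_num
  have hsum2 : ∀ t ∈ S, MemLp (fun ω => 3 + |Z s ω| + |Z t ω|) 2 P := fun t ht =>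
    memLp_three_add_abs (hZ_L2 s hs) (hZ_L2 t ht)
  have hQi : ∀ t ∈ S, Integrable (Q t) P := fun t ht => hWi.add (hsum2 t ht).integrable_sq
  have hK8i : ∀ t ∈ S, Integrable (fun ω => K t ω ^ 8) P := fun t ht => by
    simpa only [hK8] using hQi t ht
  -- A bound for `E K ^ 8` independent of `t`, by the common bound `V` on second moments.
  set q := ∫ ω, W ω ∂P + 3 * (9 + V + V) with hq
  have hq0 : 0 ≤ q := add_nonneg (integral_nonneg hW0) (by positivity)
  have hKq : ∀ t ∈ S, ∫ ω, K t ω ^ 8 ∂P ≤ q := fun t ht => by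
    simp only [hK8]
    rw [hQ, integral_add hWi (hsum2 t ht).integrable_sq, hq]
    gcongr
    refine (integral_three_add_abs_sq_le (hZ_L2 s hs) (hZ_L2 t ht)).trans ?_
    gcongr <;> exact hV _ ‹_›
  have hT : ∀ t, ∀ᵐ ω ∂P, |f (Z s ω) ω| ≤ 4 * K t ω ∧ |f (Z t ω) ω| ≤ 4 * K t ω ∧
      |deriv (fun x => f x ω) (Z s ω)| ≤ 3 * K t ω ∧
      HasDerivAt (fun x => f x ω) (deriv (fun x => f x ω) (Z s ω)) (Z s ω) ∧
      (f (Z t ω) ω - f (Z s ω) ω - deriv (fun x => f x ω) (Z s ω) * (Z t ω - Z s ω)) ^ 2 ≤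
        128 * K t ω ^ 2 * |Z t ω - Z s ω| ^ 3 := fun t => by
    filter_upwards [hf_path, hWae] with ω h1 h2
    exact taylor_of_dyadic_bound h1 (hW0 ω) h2.1 h2.2 (hK0 t ω) (hK8 t ω)
  have hderiv : AEMeasurable (fun ω => deriv (fun x => f x ω) (Z s ω)) P :=
    aemeasurable_deriv_eval hfm hf_path (hZm s hs)
      ((hT s).mono fun ω h => h.2.2.2.1.differentiableAt)
  have hD4i : ∀ i, Integrable (fun ω => D i ω ^ 4) P := fun i => by
    have := (hD4 i).integrable_norm_pow (p := 4) (by norm_num)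
    simpa [Even.pow_abs (show Even 4 by decide)] using this
  refine ⟨memLp_two_of_sq_le (aemeasurable_eval_of_continuous hfm hf_path (hZm s hs))
    (((integrable_const 1).add (hK8i s hs)).const_mul 16) ?_,
    fun i ω => deriv (fun x => f x ω) (Z s ω) * D i ω, fun i => ?_, ?_⟩
  · filter_upwards [hT s] with ω h
    have h1 := pow_le_pow_left₀ (abs_nonneg _) h.1 2
    rw [sq_abs] at h1
    simp only [Pi.add_apply]
    nlinarith [sq_nonneg (K s ω ^ 2 - 1), sq_nonneg (K s ω ^ 4 - 1)]
  · refine memLp_two_of_sq_le (hderiv.mul (hD2 i).aestronglyMeasurable.aemeasurable)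
      ((((integrable_const 1).add (hK8i s hs)).add (hD4i i)).const_mul 9) ?_
    filter_upwards [hT s] with ω h
    have h1 := pow_le_pow_left₀ (abs_nonneg _) h.2.2.1 2
    rw [sq_abs] at h1
    simp only [Pi.add_apply]
    have h2 := mul_le_mul_of_nonneg_right h1 (sq_nonneg (D i ω))
    rw [mul_pow]
    nlinarith [sq_nonneg (K s ω ^ 2 - D i ω ^ 2), sq_nonneg (K s ω ^ 4 - 1)]
  · set E : Ω → ℝ := fun ω => |D 0 ω| + |D 1 ω| with hE
    have hE4i : Integrable (fun ω => E ω ^ 4) P := by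
      have := ((hD4 0).abs.add (hD4 1).abs).integrable_norm_pow (p := 4) (by norm_num)
      simpa [Even.pow_abs (show Even 4 by decide)] using this
    set d := ∫ ω, E ω ^ 4 ∂P with hd
    have hd0 : 0 ≤ d := integral_nonneg fun ω => by positivity
    rw [ENNReal.tendsto_nhds_zero]
    intro ε' hε'
    obtain ⟨b, hb0, hbε⟩ := ENNReal.lt_iff_exists_nnreal_btwn.1 hε'
    have hb : (0 : ℝ) < b := by exact_mod_cast hb0
    -- With this `ε` the terms in `K` and the gradient contribute at most `b ^ 2 / 2`; `u₀` below
    -- does the same for the terms with factor `C`.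
    set ε := (b : ℝ) ^ 2 / (2 * (q + d + 1)) with hε
    have hε0 : 0 < ε := by positivity
    obtain ⟨C, hC0, hC⟩ := exists_sq_error_le hε0
    set u₀ := min 1 ((b : ℝ) ^ 2 / (2 * (C * (d + A ^ 2) + 1))) with hu₀
    have hu₀0 : 0 < u₀ := lt_min one_pos (by positivity)
    filter_upwards [self_mem_nhdsWithin, nhdsWithin_le_nhds
      (Metric.closedBall_mem_nhds s (show 0 < u₀ ^ 3 by positivity))] with t ht ht1
    rw [mem_closedBall_iff_norm] at ht1
    have hpos : 0 < ‖t - s‖ := norm_pos_iff.2 (sub_ne_zero.2 ht.2)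
    -- The cube root of the distance is the truncation level. As `E r ^ 2 ≤ A ^ 2 * u ^ 12`, the
    -- term `r ^ 2 / u ^ 10` has expectation at most `A ^ 2 * u ^ 2`.
    obtain ⟨u, hu, hu3⟩ : ∃ u : ℝ, 0 < u ∧ u ^ 3 = ‖t - s‖ :=
      ⟨‖t - s‖ ^ (1 / 3 : ℝ), Real.rpow_pos_of_pos hpos _, by
        rw [← Real.rpow_natCast, ← Real.rpow_mul hpos.le]; norm_num⟩
    have huu₀ : u ≤ u₀ := le_of_pow_le_pow_left₀ three_ne_zero hu₀0.le (hu3.trans_le ht1)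
    have hu1 : u ≤ 1 := huu₀.trans (min_le_left _ _)
    have hts1 : ‖t - s‖ ≤ 1 := by rw [← hu3]; exact pow_le_one₀ hu.le hu1
    have hm : MemLp (fun ω => Z t ω - Z s ω - ∑ i, (t i - s i) * D i ω) 2 P :=
      ((hZ_L2 t ht.1).sub (hZ_L2 s hs)).sub (memLp_finsetSum _ fun i _ => (hD2 i).const_mul _)
    have hr := hDA t ht.1 hts1
    set r : Ω → ℝ := fun ω => Z t ω - Z s ω - ∑ i, (t i - s i) * D i ω with hr_def
    have hint1 : Integrable (fun ω => ε * (K t ω ^ 8 + E ω ^ 4 + 1)) P :=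
      (((hK8i t ht.1).add hE4i).add (integrable_const 1)).const_mul ε
    have hint2 : Integrable (fun ω => C * (u ^ 4 * E ω ^ 4 + r ω ^ 2 / u ^ 10)) P :=
      ((hE4i.const_mul _).add (hm.integrable_sq.div_const _)).const_mul C
    refine (eLpNorm_two_le_of_sq_le (b := b) (hint1.add hint2) ?_ hb.le ?_).trans ?_
    · filter_upwards [hT t] with ω h
      have hv : |∑ i, (t i - s i) * D i ω| ≤ u ^ 3 * E ω := by
        rw [hu3, Fin.sum_univ_two, hE, mul_add]
        refine (abs_add_le _ _).trans ?_
        rw [abs_mul, abs_mul]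
        have hc : ∀ i, |t i - s i| ≤ ‖t - s‖ := fun i => PiLp.norm_apply_le (t - s) i
        gcongr <;> exact hc _
      have hE0 : 0 ≤ E ω := by positivity
      obtain ⟨e1, e2⟩ := sq_linearization_error_le hu hE0 hv h.2.2.1 h.1 h.2.1 h.2.2.2.2
      have e3 := hC u (K t ω) (E ω) |r ω| _ hu hu1 (hK0 t ω) hE0 (abs_nonneg _) e1 e2
      rw [sq_abs] at e3
      refine le_trans (le_of_eq ?_) e3
      rw [div_pow, ← hu3, ← pow_mul]
      congr 2
      rw [Finset.mul_sum]
      congr 1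
      exact Finset.sum_congr rfl fun i _ => by ring
    · change ∫ ω, (ε * (K t ω ^ 8 + E ω ^ 4 + 1) + C * (u ^ 4 * E ω ^ 4 + r ω ^ 2 / u ^ 10)) ∂P ≤ _
      rw [integral_add hint1 hint2, integral_const_mul, integral_const_mul,
        integral_add (f := fun ω => K t ω ^ 8 + E ω ^ 4) ((hK8i t ht.1).add hE4i)
          (integrable_const 1), integral_add (hK8i t ht.1) hE4i,
        integral_add (hE4i.const_mul _) (hm.integrable_sq.div_const _), integral_const_mul,
        integral_div, ← hd]
      simp only [integral_const, probReal_univ, smul_eq_mul, mul_one]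
      have a1 : ε * (∫ ω, K t ω ^ 8 ∂P + d + 1) ≤ (b : ℝ) ^ 2 / 2 := by
        calc _ ≤ ε * (q + d + 1) := by gcongr; exact hKq t ht.1
          _ = _ := by rw [hε]; field_simp
      have a2 : (∫ ω, r ω ^ 2 ∂P) / u ^ 10 ≤ A ^ 2 * u ^ 2 := by
        rw [div_le_iff₀ (by positivity)]
        refine hr.trans (le_of_eq ?_)
        rw [← hu3]; ring
      have hu2 : u ^ 2 ≤ u := by nlinarith
      have hu4 : u ^ 4 ≤ u := by nlinarith [sq_nonneg u]
      have a3 : C * (u ^ 4 * d + (∫ ω, r ω ^ 2 ∂P) / u ^ 10) ≤ (b : ℝ) ^ 2 / 2 := by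
        calc _ ≤ C * (u * d + A ^ 2 * u) := by gcongr; exact a2.trans (by gcongr)
          _ = C * (d + A ^ 2) * u := by ring
          _ ≤ (C * (d + A ^ 2) + 1) * ((b : ℝ) ^ 2 / (2 * (C * (d + A ^ 2) + 1))) := by
            gcongr
            · linarith
            · exact huu₀.trans (min_le_right _ _)
          _ = _ := by field_simp
      linarith
    · rw [ENNReal.ofReal_coe_nnreal]; exact hbε.le
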